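/- Let $n\ge 1$, $\alpha=\pi/(2n+1)$, and let $\Delta_0\subset\mathbb{E}^2$ be an isosceles triangle with angles $\alpha,n\alpha,n\alpha$. *Setting.* Represent an oriented line by an affine function $f(p)=\langle a,p\rangle+c$ on $\mathbb{E}^2$ with $\langle a,a\rangle=2$, put $(f,g)=\langle a_f,a_g\rangle$ and $\Pi_f=\{f<0\}$. A seed $(\mathbf v,B)$, up to simultaneous permutation of indices, consists of three such functions $v_1,v_2,v_3$ and a skew-symmetric real $3\times3$ matrix $B$ with $|b_{ij}|=|(v_i,v_j)|$, regarded as a quiver ($i\to j$ iff $b_{ij}>0$) on the sides of the triangle (or infinite region bounded by a segment and two parallel half-lines) $\Delta=\bigcap_i\Pi_{v_i}$. The initial seed is $\Delta_0$ with the acyclic quiver base $\to$ first leg $\to$ second leg, base $\to$ second leg. The belt line $b$ is the line through the feet of the altitudes of $\Delta_0$ on the source and on the sink. A function $f$ is positive if all sufficiently far points of $b$, in the direction from the source to the sink, lie in $\Pi_f$. The mutation $\mu_k$ mutates $B$ as usual, replaces $v_k$ by $-v_k$, and replaces $v_i$ ($i\ne k$) by $v_i-(v_i,v_k)v_k$ if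 $v_k$ is positive and $b_{ik}<0$, or if $v_k$ is not positive and $b_{ik}>0$; the other $v_i$ are kept. The exchange graph $\Gamma$ has as vertices all seeds obtained from the initial seed by sequences of mutations, and as edges single mutations. A seed is translated or reflected by moving its triangle and keeping its quiver. An acyclic belt is a maximal connected full subgraph of $\Gamma$ containing only seeds with acyclic quiver. The initial acyclic belt is $I=(I_m)_{m\in\mathbb Z}$, where $I_0$ is the initial seed and $I_{m+1}$ is obtained from $I_m$ by mutation at a source. Let $L$ be the $\mathbb Z$-module spanned by the lengths of all vectors $w$ such that $\Gamma$ contains two seeds that differ by translation by $w$; identify $l\in L$ with the vector $l\,e$, where $e$ is the unit vector along $b$ from the source to the sink. **Theorem.** 1. The belt $I$ exists, and for every $w\in L$ the translated path $I+w$, with vertices $(I_m+w)_{m\in\mathbb Z}$ and edges between consecutive vertices, is a full subgraph of $\Gamma$; it is an acyclic belt. 2. There is a vector $h$ with $2h\in L$ such that the following holds. Let $n_1,n_2,n_3\ge0$ be integers with $n_1+n_2+n_3=2n+1$ and $\gcd(n_1,n_2,n_3)=1$. There is a triangle (an infinite region, if some $n_i=0$) $\Delta$ with angles $n_1\alpha,n_2\alpha,n_3\alpha$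 ($n_i\alpha$ opposite to the side $i$) to which every triangle or region with these angles that occurs in $\Gamma$ is congruent. Let $Q$ be a quiver on the sides of $\Delta$ whose arrow between two sides that enclose the angle $\theta$ has weight $2|\cos\theta|$, and which is acyclic if $\Delta$ is acute-angled and cyclic if $\Delta$ has an obtuse angle; if $\Delta$ is an infinite region, let moreover the arrow between the two sides of the obtuse angle start at the finite side. Then, up to translation by vectors in $L$, there are exactly two seeds in $\Gamma$ whose triangle is congruent to $\Delta$ and whose quiver is $Q$ (under the congruence). Any two such seeds are related by a translation by a vector in $L$, or by the glide reflection that consists of the reflection across $b$ and the translation by $h$, followed by a translation by a vector in $L$. -/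

import Mathlib

open scoped EuclideanGeometry

noncomputable section

namespace AffineSeed

/-- The Euclidean plane. -/
abbrev Plane : Type := EuclideanSpace ℝ (Fin 2)

/-- The three-dimensional space of affine linear functions on the plane: the pair `(a, c)` stands
for the function `p ↦ ⟪a, p⟫ + c`. -/
abbrev AffFun : Type := Plane × ℝ

/-- The value of an affine linear function at a point. -/
def AffFun.eval (f : AffFun) (p : Plane) : ℝ := inner ℝ f.1 p + f.2

/-- The (degenerate) symmetric bilinear form on affine linear functions: the scalar product of the
linear parts. -/
def AffFun.form (f g : AffFun) : ℝ := inner ℝ f.1 g.1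

/-- The open half-plane where an affine linear function is negative. Thus the linear part of `f` is
an outward normal vector of this half-plane. -/
def AffFun.halfPlane (f : AffFun) : Set Plane := {p | f.eval p < 0}

/-- The image of an affine linear function under an isometry `φ` of the plane, that is,
`f ∘ φ⁻¹`; see `AffFun.eval_move`. -/
def AffFun.move (φ : Plane ≃ᵃⁱ[ℝ] Plane) (f : AffFun) : AffFun :=
  (φ.linearIsometryEquiv f.1, f.eval (φ.symm 0))

theorem AffFun.eval_move (φ : Plane ≃ᵃⁱ[ℝ] Plane) (f : AffFun) (p : Plane) :
    (f.move φ).eval p = f.eval (φ.symm p) := by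
  have h : φ.symm p = φ.linearIsometryEquiv.symm p + φ.symm 0 := by
    have := φ.symm.map_vadd (0 : Plane) p
    rw [vadd_eq_add, vadd_eq_add, add_zero] at this
    exact this
  simp only [AffFun.move, AffFun.eval, h, inner_add_right]
  rw [← φ.linearIsometryEquiv.inner_map_map f.1 (φ.linearIsometryEquiv.symm p)]
  simp [add_assoc]

/-- The domain of a triple of affine linear functions: the intersection of the three half-planes.
For a seed this is an open triangle, or an infinite region bounded by two parallel half-lines and
a segment. -/
def domain (v : Fin 3 → AffFun) : Set Plane := ⋂ i, (v i).halfPlane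

/-- The domain of `v` is a triangle or an infinite region with interior angles `θ`. The angle `θ i`
is opposite to the side `i`, so it is the interior angle between the sides `i + 1` and `i + 2`,
hence the supplement of the angle between their outward normal vectors (it is `0` if these sides are
parallel with opposite outward normal vectors). -/
def HasAngles (v : Fin 3 → AffFun) (θ : Fin 3 → ℝ) : Prop :=
  (domain v).Nonempty ∧
    ∀ i, Real.pi - InnerProductGeometry.angle (v (i + 1)).1 (v (i + 2)).1 = θ i

/-- Congruence of domains with labelled sides. -/
def AreCongruent (v v' : Fin 3 → AffFun) : Prop :=
  ∃ φ : Plane ≃ᵃⁱ[ℝ] Plane, ∀ i, v i = (v' i).move φ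

/-! ### Exchange matrices -/

/-- Matrix mutation. -/
def mutateMatrix (B : Matrix (Fin 3) (Fin 3) ℝ) (k : Fin 3) : Matrix (Fin 3) (Fin 3) ℝ :=
  fun i j => if k = i ∨ k = j then -B i j
    else B i j + (B i k * |B k j| + |B i k| * B k j) / 2

/-- The quiver of `B` (with an arrow `i → j` whenever `B i j > 0`) has no oriented cycle. -/
def IsAcyclic (B : Matrix (Fin 3) (Fin 3) ℝ) : Prop :=
  ∀ i, ¬ Relation.TransGen (fun a b => 0 < B a b) i i

/-- The vertex `k` of the quiver of `B` is a source. -/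
def IsSource (B : Matrix (Fin 3) (Fin 3) ℝ) (k : Fin 3) : Prop := ∀ i, 0 ≤ B k i

/-! ### Seeds and their mutations -/

/-- A triple of vectors together with an exchange matrix, with labelled entries. The initial seed
below is a geometric realisation of its matrix, that is, the vectors `v i` form a basis of squared
lengths `2`, the absolute values of their products are those of the entries of `B`, and the signs of
these products are compatible with `B`; mutation preserves this. -/
@[ext]
structure LabelledSeed where
  /-- the vectors of the geometric realisation -/
  v : Fin 3 → AffFun
  /-- the exchange matrix -/
  B : Matrix (Fin 3) (Fin 3) ℝ

/-- Simultaneous permutation of vectors and of rows and columns. -/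
def LabelledSeed.perm (x : LabelledSeed) (σ : Equiv.Perm (Fin 3)) : LabelledSeed :=
  ⟨x.v ∘ σ, x.B.submatrix σ σ⟩

/-- Two labelled seeds are identified if they differ by a permutation of the labels. -/
instance seedSetoid : Setoid LabelledSeed where
  r x y := ∃ σ : Equiv.Perm (Fin 3), y = x.perm σ
  iseqv :=
    { refl := fun x => ⟨1, by ext <;> simp [LabelledSeed.perm]⟩
      symm := by
        rintro x _ ⟨σ, rfl⟩
        exact ⟨σ⁻¹, by ext <;> simp [LabelledSeed.perm]⟩
      trans := by
        rintro x _ _ ⟨σ, rfl⟩ ⟨τ, rfl⟩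
        exact ⟨σ * τ, by ext <;> simp [LabelledSeed.perm]⟩ }

/-- Seeds, up to permutation of the labels. -/
abbrev Seed : Type := Quotient seedSetoid

/-- The image of a labelled seed under an isometry of the plane, with the same quiver. -/
def LabelledSeed.move (φ : Plane ≃ᵃⁱ[ℝ] Plane) (x : LabelledSeed) : LabelledSeed :=
  ⟨fun i => (x.v i).move φ, x.B⟩

/-- The image of a seed under an isometry of the plane, with the same quiver. -/
def Seed.move (φ : Plane ≃ᵃⁱ[ℝ] Plane) : Seed → Seed :=
  Quotient.map (LabelledSeed.move φ) (by
    rintro x _ ⟨σ, rfl⟩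
    exact ⟨σ, rfl⟩)

/-- The translated seed `w + s`. -/
def Seed.translate (w : Plane) (s : Seed) : Seed :=
  s.move (AffineIsometryEquiv.constVAdd ℝ Plane w)

/-- The exchange matrix of a seed is acyclic. -/
def Seed.IsAcyclic (s : Seed) : Prop :=
  ∃ x : LabelledSeed, (⟦x⟧ : Seed) = s ∧ AffineSeed.IsAcyclic x.B

open Classical in
/-- Seed mutation in direction `k` by partial reflections, with respect to a set `pos` of positive
vectors. -/
def LabelledSeed.mutate (pos : Set AffFun) (x : LabelledSeed) (k : Fin 3) : LabelledSeed where
  v := fun i =>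
    if i = k then -x.v k
    else if (x.v k ∈ pos ∧ x.B i k < 0) ∨ (x.v k ∉ pos ∧ 0 < x.B i k) then
      x.v i - (x.v i).form (x.v k) • x.v k
    else x.v i
  B := mutateMatrix x.B k

/-! ### The initial seed, the belt line and the exchange graph -/

/-- The affine linear function, with linear part of squared length `2`, that vanishes on the side of
`Δ` opposite to the vertex `i` and that is negative at the vertex `i`. -/
def sideFun (Δ : Affine.Triangle ℝ Plane) (i : Fin 3) : AffFun :=
  let a : Plane := (√2 / ‖Δ.altitudeFoot i - Δ.points i‖) • (Δ.altitudeFoot i - Δ.points i)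
  (a, -inner ℝ a (Δ.altitudeFoot i))

/-- The fundamental angle. -/
def fundAngle (n : ℕ) : ℝ := Real.pi / (2 * n + 1)

/-- `Δ` is an isosceles triangle with angle `α` at the vertex `0` and angles `n α` at the vertices
`1` and `2`. -/
def IsInitialTriangle (n : ℕ) (Δ : Affine.Triangle ℝ Plane) : Prop :=
  ∠ (Δ.points 1) (Δ.points 0) (Δ.points 2) = fundAngle n ∧
  ∠ (Δ.points 0) (Δ.points 1) (Δ.points 2) = n * fundAngle n ∧
  ∠ (Δ.points 0) (Δ.points 2) (Δ.points 1) = n * fundAngle n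

/-- The initial labelled seed. The side `i` is opposite to the vertex `i`; the arrows of the quiver
are `0 → 1`, `0 → 2` and `1 → 2`, so the base `0` is the source and the leg `2` is the sink. -/
def initialLabelledSeed (n : ℕ) (Δ : Affine.Triangle ℝ Plane) : LabelledSeed where
  v := sideFun Δ
  B := !![0, 2 * Real.cos (n * fundAngle n), 2 * Real.cos (n * fundAngle n);
          -(2 * Real.cos (n * fundAngle n)), 0, 2 * Real.cos (fundAngle n);
          -(2 * Real.cos (n * fundAngle n)), -(2 * Real.cos (fundAngle n)), 0]

/-- The initial seed. -/
def initialSeed (n : ℕ) (Δ : Affine.Triangle ℝ Plane) : Seed := ⟦initialLabelledSeed n Δ⟧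

/-- The belt line: the line through the feet of the altitudes of the initial triangle on the source
and on the sink. -/
def beltLine (Δ : Affine.Triangle ℝ Plane) : AffineSubspace ℝ Plane :=
  line[ℝ, Δ.altitudeFoot 0, Δ.altitudeFoot 2]

instance (Δ : Affine.Triangle ℝ Plane) : Nonempty (beltLine Δ) :=
  ⟨⟨Δ.altitudeFoot 0, left_mem_affineSpan_pair ℝ _ _⟩⟩

/-- The reflection across the belt line. -/
def beltReflection (Δ : Affine.Triangle ℝ Plane) : Plane ≃ᵃⁱ[ℝ] Plane :=
  EuclideanGeometry.reflection (beltLine Δ)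

/-- The vector along the belt line from the source to the sink. -/
def beltVector (Δ : Affine.Triangle ℝ Plane) : Plane := Δ.altitudeFoot 2 - Δ.altitudeFoot 0

/-- The positive vectors. The reference point lies infinitely far away on the belt line in the
direction from the source to the sink: it belongs to a half-plane if all points of the belt line
that are far enough in this direction do. -/
def positive (Δ : Affine.Triangle ℝ Plane) : Set AffFun :=
  {f | ∀ᶠ t : ℝ in Filter.atTop, Δ.altitudeFoot 0 + t • beltVector Δ ∈ f.halfPlane}

/-- The vertices of the exchange graph: the seeds obtained from the initial seed by sequences of
mutations. -/
def mutationClass (n : ℕ) (Δ : Affine.Triangle ℝ Plane) : Set Seed :=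
  {s | ∃ x : LabelledSeed, (⟦x⟧ : Seed) = s ∧
    Relation.ReflTransGen (fun y z => ∃ k, z = y.mutate (positive Δ) k)
      (initialLabelledSeed n Δ) x}

/-- The exchange graph of the initial seed. -/
def exchangeGraph (n : ℕ) (Δ : Affine.Triangle ℝ Plane) : SimpleGraph (mutationClass n Δ) :=
  SimpleGraph.fromRel fun s t => ∃ (x : LabelledSeed) (k : Fin 3),
    (⟦x⟧ : Seed) = s ∧ (⟦x.mutate (positive Δ) k⟧ : Seed) = t

/-- An acyclic belt: (the vertex set of) a maximal connected full subgraph of the exchange graph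
that contains only acyclic seeds. -/
def IsAcyclicBelt (n : ℕ) (Δ : Affine.Triangle ℝ Plane) (J : Set (mutationClass n Δ)) : Prop :=
  Maximal (fun K : Set (mutationClass n Δ) =>
    (∀ s ∈ K, (s : Seed).IsAcyclic) ∧ ((exchangeGraph n Δ).induce K).Connected) J

/-- The labelling of the initial acyclic belt: `I 0` is the initial seed and `I (m + 1)` is obtained
from `I m` by a mutation at a source. -/
def IsInitialBelt (n : ℕ) (Δ : Affine.Triangle ℝ Plane) (I : ℤ → mutationClass n Δ) : Prop :=
  (I 0 : Seed) = initialSeed n Δ ∧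
  ∀ m, ∃ (x : LabelledSeed) (k : Fin 3), (⟦x⟧ : Seed) = I m ∧ IsSource x.B k ∧
    (⟦x.mutate (positive Δ) k⟧ : Seed) = I (m + 1)

/-- The group of real numbers spanned by the lengths of all translation vectors between seeds of the
exchange graph. -/
def lengthLattice (n : ℕ) (Δ : Affine.Triangle ℝ Plane) : AddSubgroup ℝ :=
  AddSubgroup.closure {l | ∃ (w : Plane) (s t : mutationClass n Δ),
    (s : Seed) = (t : Seed).translate w ∧ l = ‖w‖}

/-- The translation lattice `L`, as a group of vectors: a real number `l` of `lengthLattice` is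
identified with `l` times the unit vector along the belt line. -/
def translationLattice (n : ℕ) (Δ : Affine.Triangle ℝ Plane) : AddSubgroup Plane :=
  (lengthLattice n Δ).map
    ((LinearMap.toSpanSingleton ℝ Plane (‖beltVector Δ‖⁻¹ • beltVector Δ)).toAddMonoidHom)

/-- `Q` is a quiver on the sides of a triangle or an infinite region with angles `θ`, where `θ i` is
opposite to the side `i`. Its weights are given by the angles, it is acyclic in the acute-angled case
and cyclic in the obtuse-angled case. In the case of an infinite region with finite side `i`, the
arrow between the two sides `i` and `k` of the obtuse angle starts at `i`. -/
structure IsQuiverOf (θ : Fin 3 → ℝ) (Q : Matrix (Fin 3) (Fin 3) ℝ) : Prop where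
  skew : ∀ i j, Q j i = -Q i j
  weight : ∀ i, |Q (i + 1) (i + 2)| = 2 * |Real.cos (θ i)|
  acute : (∀ i, θ i < Real.pi / 2) → IsAcyclic Q
  obtuse : (∃ i, Real.pi / 2 < θ i) → ¬ IsAcyclic Q
  infinite : ∀ i j k, i ≠ j → j ≠ k → i ≠ k → θ i = 0 → Real.pi / 2 < θ j → 0 < Q i k

/-- The vertices of the exchange graph whose triangle (or infinite region) is congruent to the one
given by `D` and whose quiver is `Q`, for some labelling of their sides. -/
def seedsOfShape (n : ℕ) (Δ : Affine.Triangle ℝ Plane) (D : Fin 3 → AffFun)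
    (Q : Matrix (Fin 3) (Fin 3) ℝ) : Set (mutationClass n Δ) :=
  {s | ∃ x : LabelledSeed, (⟦x⟧ : Seed) = s ∧ AreCongruent x.v D ∧ x.B = Q}

end AffineSeed

end

/-!
Use Cartesian coordinates whose first axis is the belt line. A seed of the exchange graph is then
determined by four parameters: the angles `aα` and `cα` opposite to the sides through which the belt
line enters and leaves the triangle, an orientation `±1` and a position along the belt line. On the
pair `(a, c)` the three mutations act as a subtractive Euclidean algorithm, and they commute with
the glides along the belt line. Hence every pair with `gcd (a, c, 2n + 1) = 1` is reached from the
initial pair `(1, n)`, and two seeds with the same pair differ by a translation or a glide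
reflection according to their orientations. Three successive source mutations of the initial seed
amount to such a glide reflection, so both orientations occur.
-/

noncomputable section

namespace AffineSeed

/-! ### Affine functions, seeds and isometries -/

theorem AffFun.ext_eval {f g : AffFun} (h : ∀ p, f.eval p = g.eval p) : f = g := by
  have h0 : f.2 = g.2 := by simpa [AffFun.eval] using h 0
  refine Prod.ext (ext_inner_right ℝ fun p => ?_) h0
  have := h p
  simp only [AffFun.eval, h0] at this
  linarith

theorem AffFun.form_comm (f g : AffFun) : f.form g = g.form f := real_inner_comm _ _

theorem AffFun.form_move (φ : Plane ≃ᵃⁱ[ℝ] Plane) (f g : AffFun) :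
    (f.move φ).form (g.move φ) = f.form g := by
  simp [AffFun.move, AffFun.form]

theorem AffFun.reflect_reflect {f g : AffFun} (hg : g.form g = 2) :
    (f - f.form g • g) - (f - f.form g • g).form (-g) • (-g) = f := by
  have : (f - f.form g • g).form (-g) = f.form g := by
    simp only [AffFun.form, Prod.fst_sub, Prod.smul_fst, Prod.fst_neg, inner_neg_right,
      inner_sub_left, real_inner_smul_left] at hg ⊢
    rw [hg]
    ring
  rw [this]
  simp

theorem mutateMatrix_mutateMatrix (B : Matrix (Fin 3) (Fin 3) ℝ) (k : Fin 3) :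
    mutateMatrix (mutateMatrix B k) k = B := by
  ext i j
  by_cases h : k = i ∨ k = j
  · simp [mutateMatrix, h]
  · simp only [mutateMatrix, h, if_false, true_or, or_true, if_true, abs_neg]
    ring

namespace LabelledSeed

variable {pos : Set AffFun} {x y : LabelledSeed} {k i : Fin 3}

theorem ext_sides (h₀ : x.v 0 = y.v 0) (h₁ : x.v 1 = y.v 1) (h₂ : x.v 2 = y.v 2)
    (hB : x.B = y.B) : x = y :=
  LabelledSeed.ext (funext fun i => by fin_cases i <;> assumption) hB

theorem mk_perm (x : LabelledSeed) (σ : Equiv.Perm (Fin 3)) : (⟦x.perm σ⟧ : Seed) = ⟦x⟧ :=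
  (Quotient.sound (show x ≈ x.perm σ from ⟨σ, rfl⟩)).symm

theorem mk_eq_iff : (⟦x⟧ : Seed) = ⟦y⟧ ↔ ∃ σ, y = x.perm σ := Quotient.eq

/-- The condition under which the mutation at `k` reflects the side `i`. -/
def Reflects (pos : Set AffFun) (x : LabelledSeed) (k i : Fin 3) : Prop :=
  (x.v k ∈ pos ∧ x.B i k < 0) ∨ (x.v k ∉ pos ∧ 0 < x.B i k)

theorem mutate_v_self (pos : Set AffFun) (x : LabelledSeed) (k : Fin 3) :
    (x.mutate pos k).v k = -x.v k := by
  simp [mutate]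

theorem mutate_v_of_reflects (hi : i ≠ k) (h : x.Reflects pos k i) :
    (x.mutate pos k).v i = x.v i - (x.v i).form (x.v k) • x.v k := by
  rw [Reflects] at h
  simp only [mutate, hi, if_false, if_pos h]

theorem mutate_v_of_not_reflects (hi : i ≠ k) (h : ¬ x.Reflects pos k i) :
    (x.mutate pos k).v i = x.v i := by
  rw [Reflects] at h
  simp only [mutate, hi, if_false, if_neg h]

theorem perm_mutate (pos : Set AffFun) (x : LabelledSeed) (σ : Equiv.Perm (Fin 3)) (k : Fin 3) :
    (x.perm σ).mutate pos k = (x.mutate pos (σ k)).perm σ := by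
  ext1
  · funext i
    simp only [mutate, perm, Function.comp_apply, Matrix.submatrix_apply, σ.injective.eq_iff]
    congr
  · ext i j
    simp [mutate, perm, mutateMatrix]

/-- The hypothesis `hpos` excludes that the side `k` lies on the belt line. -/
theorem mutate_mutate (hk : (x.v k).form (x.v k) = 2) (hpos : -x.v k ∈ pos ↔ x.v k ∉ pos) :
    (x.mutate pos k).mutate pos k = x := by
  refine LabelledSeed.ext (funext fun i => ?_) (mutateMatrix_mutateMatrix x.B k)
  obtain rfl | hi := eq_or_ne i k
  · rw [mutate_v_self, mutate_v_self, neg_neg]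
  have hr : (x.mutate pos k).Reflects pos k i ↔ x.Reflects pos k i := by
    simp only [Reflects, mutate, mutateMatrix, if_true, or_true, hpos, Left.neg_neg_iff,
      Left.neg_pos_iff]
    tauto
  by_cases h : x.Reflects pos k i
  · rw [mutate_v_of_reflects hi (hr.2 h), mutate_v_of_reflects hi h, mutate_v_self,
      AffFun.reflect_reflect hk]
  · rw [mutate_v_of_not_reflects hi (mt hr.1 h), mutate_v_of_not_reflects hi h]

end LabelledSeed

/-! ### Cartesian coordinates -/

/-- A Cartesian coordinate system of the plane with a unit of length. The unit makes the standard
seeds below independent of the size of the initial triangle. -/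
structure Frame where
  /-- the origin -/
  origin : Plane
  /-- the coordinate directions -/
  b : OrthonormalBasis (Fin 2) ℝ Plane
  /-- the unit of length -/
  unit : ℝ
  unit_pos : 0 < unit

namespace Frame

variable (F : Frame)

/-- The vector with given coordinates. -/
def vec (r s : ℝ) : Plane := F.unit • (r • F.b 0 + s • F.b 1)

/-- The point with given coordinates. -/
def pt (r s : ℝ) : Plane := F.origin + F.vec r s

/-- The affine function `(r, s) ↦ √2 * unit * (X r + Y s + Z)`, whose linear part has squared
length `2 (X² + Y²)`. -/
def coordFun : ℝ × ℝ × ℝ →ₗ[ℝ] AffFun where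
  toFun q := (√2 • (q.1 • F.b 0 + q.2.1 • F.b 1),
    √2 * (F.unit * q.2.2) - inner ℝ (√2 • (q.1 • F.b 0 + q.2.1 • F.b 1)) F.origin)
  map_add' p q := by
    ext1
    · simp only [Prod.fst_add, Prod.snd_add]; module
    · simp only [Prod.fst_add, Prod.snd_add, real_inner_smul_left, inner_add_left]; ring
  map_smul' t q := by
    ext1
    · simp only [Prod.smul_fst, Prod.smul_snd, smul_eq_mul, RingHom.id_apply]; module
    · simp only [Prod.smul_fst, Prod.smul_snd, real_inner_smul_left, inner_add_left, smul_eq_mul,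
        RingHom.id_apply]
      ring

theorem inner_basis (i j : Fin 2) : inner ℝ (F.b i) (F.b j) = if i = j then (1 : ℝ) else 0 :=
  orthonormal_iff_ite.1 F.b.orthonormal i j

theorem exists_vec (w : Plane) : ∃ r s, w = F.vec r s := by
  refine ⟨F.unit⁻¹ * inner ℝ (F.b 0) w, F.unit⁻¹ * inner ℝ (F.b 1) w, ?_⟩
  have h := F.b.sum_repr' w
  rw [Fin.sum_univ_two] at h
  rw [vec, smul_add, smul_smul, smul_smul, mul_inv_cancel_left₀ F.unit_pos.ne',
    mul_inv_cancel_left₀ F.unit_pos.ne', h]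

theorem exists_pt (p : Plane) : ∃ r s, p = F.pt r s := by
  obtain ⟨r, s, h⟩ := F.exists_vec (p - F.origin)
  exact ⟨r, s, by rw [pt, ← h, add_sub_cancel]⟩

theorem vec_zero_right (r : ℝ) : F.vec r 0 = (r * F.unit) • F.b 0 := by
  rw [vec]; module

theorem norm_vec_zero_right (r : ℝ) : ‖F.vec r 0‖ = |r| * F.unit := by
  rw [vec_zero_right, norm_smul, F.b.norm_eq_one, mul_one, Real.norm_eq_abs, abs_mul,
    abs_of_pos F.unit_pos]

theorem eval_coordFun (X Y Z r s : ℝ) :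
    (F.coordFun (X, Y, Z)).eval (F.pt r s) = √2 * F.unit * (X * r + Y * s + Z) := by
  simp only [coordFun, LinearMap.coe_mk, AddHom.coe_mk, AffFun.eval, pt, vec, inner_add_right,
    inner_add_left, real_inner_smul_left, real_inner_smul_right, inner_basis]
  simp only [Fin.isValue, if_true, zero_ne_one, one_ne_zero, if_false]
  ring

theorem form_coordFun (X Y Z X' Y' Z' : ℝ) :
    (F.coordFun (X, Y, Z)).form (F.coordFun (X', Y', Z')) = 2 * (X * X' + Y * Y') := by
  have h : √2 * √2 = (2 : ℝ) := Real.mul_self_sqrt (by norm_num)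
  simp only [coordFun, LinearMap.coe_mk, AddHom.coe_mk, AffFun.form, inner_add_right,
    inner_add_left, real_inner_smul_left, real_inner_smul_right, inner_basis]
  simp only [Fin.isValue, if_true, zero_ne_one, one_ne_zero, if_false]
  linear_combination (X * X' + Y * Y') * h

theorem coordFun_injective : Function.Injective F.coordFun := by
  refine (injective_iff_map_eq_zero _).2 fun ⟨X, Y, Z⟩ h => ?_
  have hval (r s : ℝ) : X * r + Y * s + Z = 0 := by
    have := F.eval_coordFun X Y Z r s
    have hu := F.unit_pos
    rw [h] at this
    simpa [AffFun.eval, hu.ne'] using this.symm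
  have h0 := hval 0 0
  have h1 := hval 1 0
  have h2 := hval 0 1
  simp only [Prod.mk_eq_zero]
  refine ⟨?_, ?_, ?_⟩ <;> linarith

/-- Positivity with respect to the point at infinity of the first coordinate axis. -/
def pos : Set AffFun := {f | ∀ᶠ t : ℝ in Filter.atTop, F.pt t 0 ∈ f.halfPlane}

theorem coordFun_mem_pos {X Y Z : ℝ} : F.coordFun (X, Y, Z) ∈ F.pos ↔ X < 0 ∨ X = 0 ∧ Z < 0 := by
  have hu : 0 < √2 * F.unit := mul_pos (by positivity) F.unit_pos
  have key (t : ℝ) : F.pt t 0 ∈ (F.coordFun (X, Y, Z)).halfPlane ↔ X * t + Z < 0 := by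
    rw [AffFun.halfPlane, Set.mem_ofPred_eq, eval_coordFun, mul_zero, add_zero,
      ← neg_pos, ← mul_neg, mul_pos_iff_of_pos_left hu, neg_pos]
  simp only [pos, Set.mem_ofPred_eq, key]
  rcases lt_trichotomy X 0 with h | rfl | h
  · refine ⟨fun _ => .inl h, fun _ => ?_⟩
    filter_upwards [Filter.eventually_gt_atTop (Z / (-X))] with t ht
    rw [div_lt_iff₀ (by linarith)] at ht
    linarith
  · simp only [zero_mul, zero_add, lt_self_iff_false, true_and, false_or, Filter.eventually_const]
  · refine ⟨fun hpos => ?_, by rintro (h' | ⟨h', -⟩) <;> linarith⟩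
    obtain ⟨t, h1, h2⟩ := (hpos.and (Filter.eventually_gt_atTop (-Z / X))).exists
    rw [div_lt_iff₀ h] at h2
    linarith

theorem neg_coordFun_mem_pos {X Y Z : ℝ} (h : X ≠ 0 ∨ Z ≠ 0) :
    -F.coordFun (X, Y, Z) ∈ F.pos ↔ F.coordFun (X, Y, Z) ∉ F.pos := by
  rw [← map_neg, Prod.neg_mk, Prod.neg_mk, coordFun_mem_pos, coordFun_mem_pos]
  rcases lt_trichotomy X 0 with hX | rfl | hX
  · simp [hX, hX.ne, hX.le]
  · obtain hZ | hZ := lt_or_gt_of_ne (h.resolve_left (by simp)) <;> simp [hZ, hZ.le]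
  · simp [hX, hX.ne', hX.le]

theorem coordFun_translate (w s X Y Z : ℝ) :
    (F.coordFun (X, Y, Z)).move (AffineIsometryEquiv.constVAdd ℝ Plane (F.vec w s)) =
      F.coordFun (X, Y, Z - w * X - s * Y) := by
  refine AffFun.ext_eval fun p => ?_
  obtain ⟨r, t, rfl⟩ := F.exists_pt p
  have : (AffineIsometryEquiv.constVAdd ℝ Plane (F.vec w s)).symm (F.pt r t) =
      F.pt (r - w) (t - s) := by
    rw [AffineIsometryEquiv.symm_apply_eq]
    simp only [AffineIsometryEquiv.coe_constVAdd, vadd_eq_add, pt, vec]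
    module
  rw [AffFun.eval_move, this, eval_coordFun, eval_coordFun]
  ring

/-- The first coordinate axis. -/
def axis : AffineSubspace ℝ Plane := AffineSubspace.mk' F.origin (Submodule.span ℝ {F.b 0})

theorem pt_zero_mem_axis (r : ℝ) : F.pt r 0 ∈ F.axis := by
  rw [axis, AffineSubspace.mem_mk', pt, vec_zero_right, vsub_eq_sub, add_sub_cancel_left]
  exact Submodule.smul_mem _ _ (Submodule.mem_span_singleton_self _)

theorem reflection_axis_pt {s : AffineSubspace ℝ Plane} [Nonempty s] (hs : s = F.axis)
    (r t : ℝ) : EuclideanGeometry.reflection s (F.pt r t) = F.pt r (-t) := by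
  have h1 : F.pt r 0 ∈ s := hs ▸ F.pt_zero_mem_axis r
  have h2 : F.vec 0 t ∈ s.directionᗮ := by
    rw [hs, axis, AffineSubspace.direction_mk', Submodule.mem_orthogonal_singleton_iff_inner_right,
      vec, zero_smul, zero_add, inner_smul_right, inner_smul_right, inner_basis]
    simp
  have h := EuclideanGeometry.reflection_orthogonal_vadd h1 h2
  rw [vadd_eq_add, vadd_eq_add] at h
  convert h using 1
  · congr 1
    simp only [pt, vec]; module
  · simp only [pt, vec]; module

theorem coordFun_reflect {s : AffineSubspace ℝ Plane} [Nonempty s] (hs : s = F.axis)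
    (X Y Z : ℝ) :
    (F.coordFun (X, Y, Z)).move (EuclideanGeometry.reflection s) = F.coordFun (X, -Y, Z) := by
  refine AffFun.ext_eval fun p => ?_
  obtain ⟨r, t, rfl⟩ := F.exists_pt p
  rw [AffFun.eval_move, EuclideanGeometry.reflection_symm, F.reflection_axis_pt hs, eval_coordFun,
    eval_coordFun]
  ring

end Frame

/-! ### Standard seeds -/

/-- The skew-symmetric matrix with given entries above the diagonal. -/
def skewMatrix (p q r : ℝ) : Matrix (Fin 3) (Fin 3) ℝ := !![0, p, r; -p, 0, q; -r, -q, 0]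

theorem skewMatrix_skew (p q r : ℝ) (i j : Fin 3) :
    skewMatrix p q r j i = -skewMatrix p q r i j := by
  fin_cases i <;> fin_cases j <;> simp [skewMatrix]

theorem mutateMatrix_skewMatrix_zero_of_neg {p q r : ℝ} (hp : 0 < p) (hr : r < 0) :
    mutateMatrix (skewMatrix p q r) 0 = skewMatrix (-p) (q + p * r) (-r) := by
  ext i j
  fin_cases i <;> fin_cases j <;> simp [mutateMatrix, skewMatrix, abs_of_pos hp, abs_of_neg hr]
  ring

theorem mutateMatrix_skewMatrix_zero_of_pos {p q r : ℝ} (hp : 0 < p) (hr : 0 < r) :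
    mutateMatrix (skewMatrix p q r) 0 = skewMatrix (-p) q (-r) := by
  ext i j
  fin_cases i <;> fin_cases j <;> simp [mutateMatrix, skewMatrix, abs_of_pos hp, abs_of_pos hr]

theorem mutateMatrix_skewMatrix_two_of_neg {p q r : ℝ} (hq : 0 < q) (hr : r < 0) :
    mutateMatrix (skewMatrix p q r) 2 = skewMatrix (p + q * r) (-q) (-r) := by
  ext i j
  fin_cases i <;> fin_cases j <;> simp [mutateMatrix, skewMatrix, abs_of_pos hq, abs_of_neg hr] <;>
    ring

/-- The quiver of a standard seed with angles `A`, `π - A - C` and `C`: acyclic if `A + C > π / 2`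
and cyclic if `A + C < π / 2`. -/
def standardQuiver (A C : ℝ) : Matrix (Fin 3) (Fin 3) ℝ :=
  skewMatrix (2 * Real.cos C) (2 * Real.cos A) (-(2 * Real.cos (A + C)))

/-- The coordinates of the sides of a standard seed with angles `A`, `π - A - C` and `C`. The first
coordinate axis enters through the side `0` at the point `(x, 0)` and leaves through the side `2`,
and it encloses the angles `π / 2 - A` and `π / 2 - C` with the normals of these sides; `ε` is the
orientation. The unit of length is normalised by `sum_sin_smul_sideCoords`. -/
def sideCoords (A C : ℝ) (ε : ℤˣ) (x : ℝ) : Fin 3 → ℝ × ℝ × ℝ :=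
  ![(-Real.sin A, ε * Real.cos A, x * Real.sin A),
    (Real.sin (A - C), -(ε * Real.cos (A - C)),
      -(x * Real.sin (A - C)) - Real.cos C / Real.sin A),
    (Real.sin C, ε * Real.cos C, -(x * Real.sin C) + Real.cos (A + C) / Real.sin A)]

/-- The seed with sides `sideCoords` and quiver `standardQuiver`. -/
def Frame.standardSeed (F : Frame) (A C : ℝ) (ε : ℤˣ) (x : ℝ) : LabelledSeed where
  v i := F.coordFun (sideCoords A C ε x i)
  B := standardQuiver A C

theorem Frame.standardSeed_v (F : Frame) (A C : ℝ) (ε : ℤˣ) (x : ℝ) (i : Fin 3) :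
    (F.standardSeed A C ε x).v i = F.coordFun (sideCoords A C ε x i) := rfl

/-- The displacement of a standard seed under the mutation at the side `0`. -/
def shift (A C : ℝ) : ℝ := Real.cos C / (Real.sin A * Real.sin (A + C))

variable {A C x : ℝ} {ε : ℤˣ}

theorem intUnit_sq (ε : ℤˣ) : ((ε : ℤ) : ℝ) ^ 2 = 1 := by
  rw [← Int.cast_pow, ← Units.val_pow_eq_pow_val, Int.units_sq, Units.val_one, Int.cast_one]

theorem mutateMatrix_standardQuiver_zero_of_pos (hC : 0 < Real.cos C) (h : 0 < Real.cos (A + C)) :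
    mutateMatrix (standardQuiver A C) 0 =
      (standardQuiver (A + C) C).submatrix (Equiv.swap 0 1) (Equiv.swap 0 1) := by
  have hcos : 2 * Real.cos A + 2 * Real.cos C * -(2 * Real.cos (A + C)) =
      -(2 * Real.cos (A + C + C)) := by
    have hA := Real.cos_sub (A + C) C
    rw [add_sub_cancel_right] at hA
    rw [hA, Real.cos_add (A + C) C]
    ring
  rw [standardQuiver, mutateMatrix_skewMatrix_zero_of_neg (by linarith) (by linarith), hcos]
  ext i j
  fin_cases i <;> fin_cases j <;>
    simp [standardQuiver, skewMatrix, Equiv.swap_apply_of_ne_of_ne]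

theorem mutateMatrix_standardQuiver_zero_of_neg (hC : 0 < Real.cos C)
    (h : Real.cos (A + C) < 0) :
    mutateMatrix (standardQuiver A C) 0 =
      (standardQuiver (Real.pi - (A + C)) A).submatrix (finRotate 3).symm (finRotate 3).symm := by
  have h0 : (finRotate 3).symm 0 = 2 := rfl
  have h1 : (finRotate 3).symm 1 = 0 := rfl
  have h2 : (finRotate 3).symm 2 = 1 := rfl
  rw [standardQuiver, mutateMatrix_skewMatrix_zero_of_pos (by linarith) (by linarith),
    standardQuiver, show Real.pi - (A + C) + A = Real.pi - C by ring, Real.cos_pi_sub,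
    Real.cos_pi_sub]
  ext i j
  fin_cases i <;> fin_cases j <;> simp [skewMatrix, h0, h1, h2]

theorem mutateMatrix_standardQuiver_two_of_pos (hA : 0 < Real.cos A) (h : 0 < Real.cos (A + C)) :
    mutateMatrix (standardQuiver A C) 2 =
      (standardQuiver A (A + C)).submatrix (Equiv.swap 1 2) (Equiv.swap 1 2) := by
  have hcos : 2 * Real.cos C + 2 * Real.cos A * -(2 * Real.cos (A + C)) =
      -(2 * Real.cos (A + (A + C))) := by
    have hC := Real.cos_sub (A + C) A
    rw [add_sub_cancel_left] at hC
    rw [hC, Real.cos_add A (A + C)]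
    ring
  rw [standardQuiver, mutateMatrix_skewMatrix_two_of_neg (by linarith) (by linarith), hcos]
  ext i j
  fin_cases i <;> fin_cases j <;>
    simp [standardQuiver, skewMatrix, Equiv.swap_apply_of_ne_of_ne]

section sideCoords

theorem sum_sin_smul_sideCoords (hA : Real.sin A ≠ 0) :
    Real.sin A • sideCoords A C ε x 0 + Real.sin (A + C) • sideCoords A C ε x 1 +
      Real.sin C • sideCoords A C ε x 2 = (0, 0, -1) := by
  have hA' := Real.sin_sq_add_cos_sq A
  have hC' := Real.sin_sq_add_cos_sq C
  have hsin : Real.sin (A + C) * Real.sin (A - C) = Real.sin A ^ 2 - Real.sin C ^ 2 := by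
    rw [Real.sin_add, Real.sin_sub]
    linear_combination Real.sin A ^ 2 * hC' - Real.sin C ^ 2 * hA'
  have hcos : Real.sin (A + C) * Real.cos (A - C) =
      Real.sin A * Real.cos A + Real.sin C * Real.cos C := by
    rw [Real.sin_add, Real.cos_sub]
    linear_combination Real.sin A * Real.cos A * hC' + Real.sin C * Real.cos C * hA'
  have hsub : Real.sin (A + C) * Real.cos C - Real.cos (A + C) * Real.sin C = Real.sin A := by
    rw [← Real.sin_sub, add_sub_cancel_right]
  simp only [sideCoords, Matrix.cons_val, Prod.smul_mk, Prod.mk_add_mk, smul_eq_mul,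
    Prod.mk.injEq]
  refine ⟨by linear_combination hsin, by linear_combination -(ε : ℝ) * hcos, ?_⟩
  field_simp
  linear_combination -x * Real.sin A * hsin - hsub

theorem neg_sideCoords_zero_eq_one (hA : Real.sin A ≠ 0) (hS : Real.sin (A + C) ≠ 0) :
    -sideCoords A C ε x 0 = sideCoords (A + C) C ε (x - shift A C) 1 := by
  simp only [sideCoords, shift, Matrix.cons_val, Prod.neg_mk, Prod.mk.injEq, add_sub_cancel_right]
  refine ⟨neg_neg _, trivial, ?_⟩
  field_simp
  ring

theorem sideCoords_one_add_smul_zero (hA : Real.sin A ≠ 0) (hS : Real.sin (A + C) ≠ 0) :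
    sideCoords A C ε x 1 + (2 * Real.cos C) • sideCoords A C ε x 0 =
      sideCoords (A + C) C ε (x - shift A C) 0 := by
  simp only [sideCoords, shift, Matrix.cons_val, Prod.smul_mk, Prod.mk_add_mk, smul_eq_mul,
    Prod.mk.injEq, Real.sin_sub, Real.cos_sub, Real.cos_add]
  refine ⟨?_, ?_, ?_⟩
  · rw [Real.sin_add]; ring
  · ring
  · field_simp
    rw [Real.sin_add]; ring

theorem sideCoords_two_eq_shift (hA : Real.sin A ≠ 0) (hS : Real.sin (A + C) ≠ 0) :
    sideCoords A C ε x 2 = sideCoords (A + C) C ε (x - shift A C) 2 := by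
  simp only [sideCoords, shift, Matrix.cons_val, Prod.mk.injEq, true_and, Real.cos_add (A + C) C]
  have hsin : Real.sin A = Real.sin (A + C) * Real.cos C - Real.cos (A + C) * Real.sin C := by
    rw [← Real.sin_sub, add_sub_cancel_right]
  field_simp
  rw [hsin]
  linear_combination (-Real.sin (A + C) * Real.cos (A + C)) * Real.sin_sq_add_cos_sq C +
    Real.sin C * Real.cos C * Real.sin_sq_add_cos_sq (A + C)

theorem neg_sideCoords_zero_eq_two (hA : Real.sin A ≠ 0) (hS : Real.sin (A + C) ≠ 0) :
    -sideCoords A C ε x 0 = sideCoords (Real.pi - (A + C)) A (-ε) (x - shift A C) 2 := by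
  simp only [sideCoords, shift, Matrix.cons_val, Prod.neg_mk, Prod.mk.injEq,
    show Real.pi - (A + C) + A = Real.pi - C by ring, Real.cos_pi_sub, Real.sin_pi_sub,
    Units.val_neg, Int.cast_neg]
  refine ⟨by ring, by ring, ?_⟩
  field_simp
  ring

theorem sideCoords_one_add_smul_zero_neg (hA : Real.sin A ≠ 0) (hS : Real.sin (A + C) ≠ 0) :
    sideCoords A C ε x 1 + (2 * Real.cos C) • sideCoords A C ε x 0 =
      sideCoords (Real.pi - (A + C)) A (-ε) (x - shift A C) 0 := by
  rw [sideCoords_one_add_smul_zero hA hS]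
  simp [sideCoords, Real.cos_pi_sub, Real.sin_pi_sub]

theorem sideCoords_two_sub_smul_zero (hA : Real.sin A ≠ 0) (hS : Real.sin (A + C) ≠ 0) :
    sideCoords A C ε x 2 - (2 * Real.cos (A + C)) • sideCoords A C ε x 0 =
      sideCoords (Real.pi - (A + C)) A (-ε) (x - shift A C) 1 := by
  have hcos : Real.cos C = Real.cos (A + C) * Real.cos A + Real.sin (A + C) * Real.sin A := by
    rw [← Real.cos_sub, add_sub_cancel_left]
  have hsin : Real.sin C = Real.sin (A + C) * Real.cos A - Real.cos (A + C) * Real.sin A := by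
    rw [← Real.sin_sub, add_sub_cancel_left]
  simp only [sideCoords, shift, Matrix.cons_val, Prod.smul_mk, Prod.mk_sub_mk, smul_eq_mul,
    Prod.mk.injEq, show Real.pi - (A + C) - A = Real.pi - (A + (A + C)) by ring, Real.cos_pi_sub,
    Real.sin_pi_sub, Real.sin_add A (A + C), Real.cos_add A (A + C), Units.val_neg, Int.cast_neg]
  refine ⟨?_, ?_, ?_⟩
  · rw [hsin]; ring
  · rw [hcos]; ring
  · field_simp
    rw [hcos, hsin]
    linear_combination (-Real.sin (A + C) * Real.cos (A + C)) * Real.sin_sq_add_cos_sq A -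
      Real.sin A * Real.cos A * Real.sin_sq_add_cos_sq (A + C)

theorem neg_sideCoords_two : -sideCoords A C ε x 2 = sideCoords A (A + C) ε x 1 := by
  simp only [sideCoords, Matrix.cons_val, Prod.neg_mk, Prod.mk.injEq, sub_add_cancel_left,
    Real.sin_neg, Real.cos_neg]
  exact ⟨trivial, trivial, by ring⟩

theorem sideCoords_one_add_smul_two (hA : Real.sin A ≠ 0) :
    sideCoords A C ε x 1 + (2 * Real.cos A) • sideCoords A C ε x 2 =
      sideCoords A (A + C) ε x 2 := by
  simp only [sideCoords, Matrix.cons_val, Prod.smul_mk, Prod.mk_add_mk, smul_eq_mul,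
    Prod.mk.injEq, Real.cos_add A (A + C), Real.sin_sub, Real.cos_sub, Real.sin_add, Real.cos_add]
  refine ⟨by ring, by ring, ?_⟩
  field_simp
  linear_combination Real.cos C * Real.sin_sq_add_cos_sq A

end sideCoords

namespace Frame

variable {F : Frame}

theorem form_standardSeed_self (i : Fin 3) :
    ((F.standardSeed A C ε x).v i).form ((F.standardSeed A C ε x).v i) = 2 := by
  have hε := intUnit_sq ε
  have key (θ : ℝ) : Real.sin θ ^ 2 + (ε : ℝ) ^ 2 * Real.cos θ ^ 2 = 1 := by
    rw [hε, one_mul, Real.sin_sq_add_cos_sq]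
  fin_cases i
  · exact (F.form_coordFun ..).trans (by linear_combination 2 * key A)
  · exact (F.form_coordFun ..).trans (by linear_combination 2 * key (A - C))
  · exact (F.form_coordFun ..).trans (by linear_combination 2 * key C)

theorem form_standardSeed_zero_one :
    ((F.standardSeed A C ε x).v 0).form ((F.standardSeed A C ε x).v 1) = -(2 * Real.cos C) := by
  simp only [standardSeed, sideCoords, Matrix.cons_val, form_coordFun]
  rw [show Real.cos C = Real.cos (A - (A - C)) by congr 1; ring, Real.cos_sub A (A - C)]
  linear_combination -2 * Real.cos A * Real.cos (A - C) * intUnit_sq ε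

theorem form_standardSeed_zero_two :
    ((F.standardSeed A C ε x).v 0).form ((F.standardSeed A C ε x).v 2) =
      2 * Real.cos (A + C) := by
  simp only [standardSeed, sideCoords, Matrix.cons_val, form_coordFun]
  rw [Real.cos_add]
  linear_combination 2 * Real.cos A * Real.cos C * intUnit_sq ε

theorem form_standardSeed_one_two :
    ((F.standardSeed A C ε x).v 1).form ((F.standardSeed A C ε x).v 2) = -(2 * Real.cos A) := by
  simp only [standardSeed, sideCoords, Matrix.cons_val, form_coordFun]
  rw [show Real.cos A = Real.cos ((A - C) + C) by congr 1; ring, Real.cos_add (A - C) C]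
  linear_combination -2 * Real.cos C * Real.cos (A - C) * intUnit_sq ε

theorem standardSeed_zero_mem_pos (hA : 0 < Real.sin A) :
    (F.standardSeed A C ε x).v 0 ∈ F.pos :=
  F.coordFun_mem_pos.2 (.inl (neg_lt_zero.2 hA))

theorem standardSeed_two_not_mem_pos (hA : 0 < Real.sin A) (hA' : 0 < Real.cos A)
    (hC : 0 < Real.sin C ∨ C = 0) : (F.standardSeed A C ε x).v 2 ∉ F.pos := by
  refine fun h => ?_
  obtain h | ⟨h, h'⟩ := F.coordFun_mem_pos.1 h
  all_goals obtain hC | rfl := hC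
  · exact h.not_gt hC
  · simp at h
  · exact h.not_gt hC
  · have : 0 < Real.cos A / Real.sin A := by positivity
    simp only [Real.sin_zero, mul_zero, neg_zero, add_zero, zero_add] at h'
    exact h'.not_gt this

theorem neg_standardSeed_mem_pos (hA : 0 < Real.sin A) (hA' : 0 < Real.cos A)
    (hC' : 0 < Real.cos C) (hC : 0 < Real.sin C ∨ C = 0) (k : Fin 3) :
    -(F.standardSeed A C ε x).v k ∈ F.pos ↔ (F.standardSeed A C ε x).v k ∉ F.pos := by
  fin_cases k
  · exact neg_coordFun_mem_pos _ (.inl (neg_ne_zero.2 hA.ne'))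
  · refine neg_coordFun_mem_pos _ (or_iff_not_imp_left.2 fun h => ?_)
    have : 0 < Real.cos C / Real.sin A := by positivity
    rw [not_not.1 h]
    linarith
  · refine neg_coordFun_mem_pos _ ?_
    obtain hC | rfl := hC
    · exact .inl hC.ne'
    · exact .inr (by simpa using ⟨hA'.ne', hA.ne'⟩)

theorem standardSeed_mutate_zero_of_pos (hA : 0 < Real.sin A) (hC : 0 < Real.cos C)
    (hS : 0 < Real.sin (A + C)) (h : 0 < Real.cos (A + C)) :
    (F.standardSeed A C ε x).mutate F.pos 0 =
      (F.standardSeed (A + C) C ε (x - shift A C)).perm (Equiv.swap 0 1) := by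
  have hpos := standardSeed_zero_mem_pos (F := F) (C := C) (ε := ε) (x := x) hA
  refine LabelledSeed.ext_sides ?_ ?_ ?_ (mutateMatrix_standardQuiver_zero_of_pos hC h)
  · rw [LabelledSeed.mutate_v_self, standardSeed_v, ← map_neg,
      neg_sideCoords_zero_eq_one hA.ne' hS.ne']
    rfl
  · rw [LabelledSeed.mutate_v_of_reflects (by decide) (.inl ⟨hpos, neg_lt_zero.2 (by positivity)⟩),
      AffFun.form_comm, form_standardSeed_zero_one, neg_smul, sub_neg_eq_add, standardSeed_v,
      standardSeed_v, ← map_smul, ← map_add, sideCoords_one_add_smul_zero hA.ne' hS.ne']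
    rfl
  · have hr : ¬(F.standardSeed A C ε x).Reflects F.pos 0 2 := by
      have hB : 0 ≤ (F.standardSeed A C ε x).B 2 0 := by
        simp [standardSeed, standardQuiver, skewMatrix, h.le]
      rintro (⟨-, h'⟩ | ⟨h', -⟩)
      exacts [hB.not_gt h', h' hpos]
    rw [LabelledSeed.mutate_v_of_not_reflects (by decide) hr, standardSeed_v,
      sideCoords_two_eq_shift hA.ne' hS.ne']
    rfl

theorem standardSeed_mutate_zero_of_neg (hA : 0 < Real.sin A) (hC : 0 < Real.cos C)
    (hS : 0 < Real.sin (A + C)) (h : Real.cos (A + C) < 0) :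
    (F.standardSeed A C ε x).mutate F.pos 0 =
      (F.standardSeed (Real.pi - (A + C)) A (-ε) (x - shift A C)).perm (finRotate 3).symm := by
  have hpos := standardSeed_zero_mem_pos (F := F) (C := C) (ε := ε) (x := x) hA
  refine LabelledSeed.ext_sides ?_ ?_ ?_ (mutateMatrix_standardQuiver_zero_of_neg hC h)
  · rw [LabelledSeed.mutate_v_self, standardSeed_v, ← map_neg,
      neg_sideCoords_zero_eq_two hA.ne' hS.ne']
    rfl
  · rw [LabelledSeed.mutate_v_of_reflects (by decide) (.inl ⟨hpos, neg_lt_zero.2 (by positivity)⟩),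
      AffFun.form_comm, form_standardSeed_zero_one, neg_smul, sub_neg_eq_add, standardSeed_v,
      standardSeed_v, ← map_smul, ← map_add, sideCoords_one_add_smul_zero_neg hA.ne' hS.ne']
    rfl
  · have hr : (F.standardSeed A C ε x).Reflects F.pos 0 2 := by
      refine .inl ⟨hpos, ?_⟩
      simp only [standardSeed, standardQuiver, skewMatrix, Matrix.of_apply, Matrix.cons_val]
      linarith
    rw [LabelledSeed.mutate_v_of_reflects (by decide) hr, AffFun.form_comm,
      form_standardSeed_zero_two, standardSeed_v, standardSeed_v, ← map_smul, ← map_sub,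
      sideCoords_two_sub_smul_zero hA.ne' hS.ne']
    rfl

theorem standardSeed_mutate_two_of_pos (hA : 0 < Real.sin A) (hA' : 0 < Real.cos A)
    (hpos : (F.standardSeed A C ε x).v 2 ∉ F.pos) (h : 0 < Real.cos (A + C)) :
    (F.standardSeed A C ε x).mutate F.pos 2 =
      (F.standardSeed A (A + C) ε x).perm (Equiv.swap 1 2) := by
  refine LabelledSeed.ext_sides ?_ ?_ ?_ (mutateMatrix_standardQuiver_two_of_pos hA' h)
  · have hr : ¬(F.standardSeed A C ε x).Reflects F.pos 2 0 := by
      have hB : (F.standardSeed A C ε x).B 0 2 ≤ 0 := by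
        simp [standardSeed, standardQuiver, skewMatrix, h.le]
      rintro (⟨h', -⟩ | ⟨-, h'⟩)
      exacts [hpos h', hB.not_gt h']
    rw [LabelledSeed.mutate_v_of_not_reflects (by decide) hr]
    rfl
  · have hr : (F.standardSeed A C ε x).Reflects F.pos 2 1 :=
      .inr ⟨hpos, by simp [standardSeed, standardQuiver, skewMatrix, hA']⟩
    rw [LabelledSeed.mutate_v_of_reflects (by decide) hr, form_standardSeed_one_two, neg_smul,
      sub_neg_eq_add, standardSeed_v, standardSeed_v, ← map_smul, ← map_add,
      sideCoords_one_add_smul_two hA.ne']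
    rfl
  · rw [LabelledSeed.mutate_v_self, standardSeed_v, ← map_neg, neg_sideCoords_two]
    rfl

theorem standardSeed_B_of_lt {i j : Fin 3} (hij : i < j) : (F.standardSeed A C ε x).B i j =
    -((F.standardSeed A C ε x).v i).form ((F.standardSeed A C ε x).v j) := by
  fin_cases i <;> fin_cases j <;> try exact absurd hij (by decide)
  · exact (congrArg Neg.neg form_standardSeed_zero_one).trans (neg_neg _) |>.symm
  · exact (congrArg Neg.neg form_standardSeed_zero_two).symm
  · exact (congrArg Neg.neg form_standardSeed_one_two).trans (neg_neg _) |>.symm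

/-- By `standardSeed_B_of_lt`, the order of the labels `i` and `j` is the relative sign of the
entries `i, j` of the Gram matrix and of the exchange matrix. -/
theorem standardSeed_perm_eq_one {G : Frame} {A' C' x' : ℝ} {ε' : ℤˣ} {σ : Equiv.Perm (Fin 3)}
    (hA' : Real.cos A' ≠ 0) (hC' : Real.cos C' ≠ 0)
    (hform : ∀ i j, ((G.standardSeed A' C' ε' x').v i).form ((G.standardSeed A' C' ε' x').v j) =
      ((F.standardSeed A C ε x).v (σ i)).form ((F.standardSeed A C ε x).v (σ j)))
    (hB : (G.standardSeed A' C' ε' x').B = (F.standardSeed A C ε x).B.submatrix σ σ) :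
    σ = 1 := by
  have hlt {i j : Fin 3} (hij : i < j)
      (h : ((G.standardSeed A' C' ε' x').v i).form ((G.standardSeed A' C' ε' x').v j) ≠ 0) :
      σ i < σ j := by
    by_contra hle
    have hσ : σ j < σ i := (not_lt.1 hle).lt_of_ne (σ.injective.ne hij.ne')
    have h1 := congrFun₂ hB i j
    have h2 : (F.standardSeed A C ε x).B (σ i) (σ j) = -(F.standardSeed A C ε x).B (σ j) (σ i) :=
      skewMatrix_skew ..
    rw [Matrix.submatrix_apply, h2, standardSeed_B_of_lt hij, standardSeed_B_of_lt hσ,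
      AffFun.form_comm (LabelledSeed.v _ (σ j)), ← hform] at h1
    exact h (by linarith)
  have h01 := hlt (i := 0) (j := 1) (by decide) (by
    rw [form_standardSeed_zero_one]; exact neg_ne_zero.2 (mul_ne_zero two_ne_zero hC'))
  have h12 := hlt (i := 1) (j := 2) (by decide) (by
    rw [form_standardSeed_one_two]; exact neg_ne_zero.2 (mul_ne_zero two_ne_zero hA'))
  exact (by decide : ∀ τ : Equiv.Perm (Fin 3), τ 0 < τ 1 → τ 1 < τ 2 → τ = 1) σ h01 h12

end Frame

/-! ### Multiples of the fundamental angle -/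

section FundAngle

variable {n j k : ℕ}

theorem fundAngle_pos (n : ℕ) : 0 < fundAngle n := by
  have := Real.pi_pos
  unfold fundAngle
  positivity

theorem two_mul_add_one_mul_fundAngle (n : ℕ) : (2 * n + 1) * fundAngle n = Real.pi := by
  unfold fundAngle
  field_simp

theorem mul_fundAngle_nonneg (n k : ℕ) : 0 ≤ k * fundAngle n :=
  mul_nonneg k.cast_nonneg (fundAngle_pos n).le

theorem mul_fundAngle_le_pi (h : k ≤ 2 * n + 1) : k * fundAngle n ≤ Real.pi := by
  rw [← two_mul_add_one_mul_fundAngle n]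
  exact mul_le_mul_of_nonneg_right (by exact_mod_cast h) (fundAngle_pos n).le

theorem mul_fundAngle_lt_pi_div_two (h : k ≤ n) : k * fundAngle n < Real.pi / 2 := by
  have : (k : ℝ) ≤ n := by exact_mod_cast h
  nlinarith [fundAngle_pos n, two_mul_add_one_mul_fundAngle n]

theorem pi_div_two_lt_mul_fundAngle (h : n < k) : Real.pi / 2 < k * fundAngle n := by
  have : (n : ℝ) + 1 ≤ k := by exact_mod_cast h
  nlinarith [fundAngle_pos n, two_mul_add_one_mul_fundAngle n]

theorem sin_mul_fundAngle_pos (h : 1 ≤ k) (h' : k ≤ 2 * n) : 0 < Real.sin (k * fundAngle n) := by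
  have hα := fundAngle_pos n
  have : (k : ℝ) ≤ 2 * n := by exact_mod_cast h'
  refine Real.sin_pos_of_pos_of_lt_pi (mul_pos (by exact_mod_cast h) hα) ?_
  nlinarith [two_mul_add_one_mul_fundAngle n]

theorem cos_mul_fundAngle_pos (h : k ≤ n) : 0 < Real.cos (k * fundAngle n) :=
  Real.cos_pos_of_mem_Ioo ⟨by linarith [mul_fundAngle_nonneg n k, Real.pi_pos],
    mul_fundAngle_lt_pi_div_two h⟩

theorem cos_mul_fundAngle_neg (h : n < k) (h' : k ≤ 2 * n + 1) :
    Real.cos (k * fundAngle n) < 0 :=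
  Real.cos_neg_of_pi_div_two_lt_of_lt (pi_div_two_lt_mul_fundAngle h)
    (by linarith [mul_fundAngle_le_pi h', Real.pi_pos])

theorem cos_mul_fundAngle_inj (hj : j ≤ 2 * n + 1) (hk : k ≤ 2 * n + 1)
    (h : Real.cos (j * fundAngle n) = Real.cos (k * fundAngle n)) : j = k := by
  have := Real.injOn_cos ⟨mul_fundAngle_nonneg n j, mul_fundAngle_le_pi hj⟩
    ⟨mul_fundAngle_nonneg n k, mul_fundAngle_le_pi hk⟩ h
  exact_mod_cast mul_right_cancel₀ (fundAngle_pos n).ne' this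

theorem sub_mul_fundAngle (h : k ≤ 2 * n + 1) :
    ((2 * n + 1 - k : ℕ) : ℝ) * fundAngle n = Real.pi - k * fundAngle n := by
  rw [Nat.cast_sub h, ← two_mul_add_one_mul_fundAngle n]
  push_cast
  ring

end FundAngle

/-! ### Mutation of the parameters of a standard seed -/

/-- The parameters of a standard seed whose angles are multiples of the fundamental angle. -/
@[ext]
structure SeedParams (n : ℕ) where
  /-- the angle opposite to the side where the belt line enters, in fundamental angles -/
  a : ℕ
  /-- the angle opposite to the side where the belt line leaves, in fundamental angles -/
  c : ℕ
  /-- the orientation -/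
  ε : ℤˣ
  /-- the position along the belt line -/
  x : ℝ
  one_le_a : 1 ≤ a
  a_le : a ≤ n
  c_le : c ≤ n

namespace SeedParams

variable {n : ℕ} (s : SeedParams n)

/-- The angle opposite to the side where the belt line enters. -/
def angleIn : ℝ := s.a * fundAngle n

/-- The angle opposite to the side where the belt line leaves. -/
def angleOut : ℝ := s.c * fundAngle n

/-- The angle between the sides where the belt line enters and leaves is at most `n` fundamental
angles. As the other two angles are so anyway, this means that the triangle is acute-angled. -/
def IsAcute : Prop := n < s.a + s.c

/-- Translation along the belt line, combined with the reflection across it if `δ = -1`. -/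
def glide (δ : ℤˣ) (r : ℝ) : SeedParams n := { s with ε := δ * s.ε, x := s.x + r }

/-- Mutation at the side where the belt line enters. -/
def mutIn : SeedParams n :=
  if h : s.a + s.c ≤ n then
    { s with
      a := s.a + s.c
      x := s.x - shift s.angleIn s.angleOut
      one_le_a := le_add_right s.one_le_a
      a_le := h }
  else
    { a := 2 * n + 1 - (s.a + s.c)
      c := s.a
      ε := -s.ε
      x := s.x - shift s.angleIn s.angleOut
      one_le_a := by have := s.a_le; have := s.c_le; omega
      a_le := by omega
      c_le := s.a_le }

/-- Mutation at the side where the belt line leaves. -/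
def mutOut : SeedParams n :=
  if h : s.a + s.c ≤ n then
    { s with
      c := s.a + s.c
      c_le := h }
  else
    { a := s.c
      c := 2 * n + 1 - (s.a + s.c)
      ε := -s.ε
      x := s.x + shift s.angleOut ((2 * n + 1 - (s.a + s.c) : ℕ) * fundAngle n)
      one_le_a := by have := s.a_le; omega
      a_le := s.c_le
      c_le := by omega }

/-- Mutation at the third side. -/
def mutMid : SeedParams n :=
  if h : s.a ≤ s.c then
    { s with
      c := s.c - s.a
      c_le := tsub_le_self.trans s.c_le }
  else
    { s with
      a := s.a - s.c
      x := s.x + shift ((s.a - s.c : ℕ) * fundAngle n) s.angleOut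
      one_le_a := by omega
      a_le := tsub_le_self.trans s.a_le }

/-- Mutation of the parameters of a standard seed, by the label of the side. -/
def mutate : Fin 3 → SeedParams n := ![s.mutIn, s.mutMid, s.mutOut]

theorem glide_one_zero : s.glide 1 0 = s := by ext <;> simp [glide]

theorem glide_glide (δ δ' : ℤˣ) (r r' : ℝ) :
    (s.glide δ r).glide δ' r' = s.glide (δ * δ') (r + r') := by
  ext <;> simp [glide, mul_comm, mul_left_comm, add_assoc]

theorem mutIn_glide (δ : ℤˣ) (r : ℝ) : (s.glide δ r).mutIn = s.mutIn.glide δ r := by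
  by_cases h : s.a + s.c ≤ n <;>
    ext <;> simp [mutIn, glide, h, angleIn, angleOut, sub_add_eq_add_sub]

theorem mutOut_glide (δ : ℤˣ) (r : ℝ) : (s.glide δ r).mutOut = s.mutOut.glide δ r := by
  by_cases h : s.a + s.c ≤ n <;>
    ext <;> simp [mutOut, glide, h, angleOut, add_right_comm]

theorem mutMid_glide (δ : ℤˣ) (r : ℝ) : (s.glide δ r).mutMid = s.mutMid.glide δ r := by
  by_cases h : s.a ≤ s.c <;>
    ext <;> simp [mutMid, glide, h, angleOut, add_right_comm]

theorem mutate_glide (δ : ℤˣ) (r : ℝ) (k : Fin 3) :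
    (s.glide δ r).mutate k = (s.mutate k).glide δ r := by
  fin_cases k
  exacts [s.mutIn_glide δ r, s.mutMid_glide δ r, s.mutOut_glide δ r]

variable {s}

theorem mutMid_mutIn (h : s.a + s.c ≤ n) : s.mutIn.mutMid = s := by
  have h' : ¬s.a + s.c ≤ s.c := by have := s.one_le_a; omega
  ext <;> simp [mutIn, mutMid, h, h', angleIn, angleOut]

theorem mutMid_mutOut (h : s.a + s.c ≤ n) : s.mutOut.mutMid = s := by
  ext <;> simp [mutOut, mutMid, h]

theorem mutOut_mutIn (h : s.IsAcute) : s.mutIn.mutOut = s := by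
  have := s.a_le; have := s.c_le
  have h1 : ¬s.a + s.c ≤ n := not_le.2 h
  have h2 : 2 * n + 1 - (s.a + s.c) + s.a = 2 * n + 1 - s.c := by omega
  have h3 : ¬2 * n + 1 - s.c ≤ n := by omega
  have h4 : 2 * n + 1 - (2 * n + 1 - s.c) = s.c := by omega
  ext <;> simp [mutIn, mutOut, h1, h2, h3, h4, angleIn, angleOut]

theorem mutIn_mutOut (h : s.IsAcute) : s.mutOut.mutIn = s := by
  have := s.a_le; have := s.c_le
  have h1 : ¬s.a + s.c ≤ n := not_le.2 h
  have h2 : s.c + (2 * n + 1 - (s.a + s.c)) = 2 * n + 1 - s.a := by omega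
  have h3 : ¬2 * n + 1 - s.a ≤ n := by omega
  have h4 : 2 * n + 1 - (2 * n + 1 - s.a) = s.a := by omega
  ext <;> simp [mutIn, mutOut, h1, h2, h3, h4, angleIn, angleOut]

theorem mutOut_mutMid (h : s.a ≤ s.c) : s.mutMid.mutOut = s := by
  ext <;> simp [mutOut, mutMid, h, s.c_le]

theorem mutIn_mutMid (h : s.c < s.a) : s.mutMid.mutIn = s := by
  ext <;> simp [mutIn, mutMid, h.not_ge, h.le, s.a_le, angleIn, angleOut]

theorem exists_mutate_mutate (s : SeedParams n) (k : Fin 3) : ∃ l, (s.mutate k).mutate l = s := by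
  fin_cases k
  · obtain h | h := le_or_gt (s.a + s.c) n
    exacts [⟨1, mutMid_mutIn h⟩, ⟨2, mutOut_mutIn h⟩]
  · obtain h | h := le_or_gt s.a s.c
    exacts [⟨2, mutOut_mutMid h⟩, ⟨0, mutIn_mutMid h⟩]
  · obtain h | h := le_or_gt (s.a + s.c) n
    exacts [⟨1, mutMid_mutOut h⟩, ⟨0, mutIn_mutOut h⟩]

/-! ### Standard seeds with given parameters -/

variable (s) (t : SeedParams n)

theorem sin_angleIn_pos : 0 < Real.sin s.angleIn :=
  sin_mul_fundAngle_pos s.one_le_a (by have := s.a_le; omega)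

theorem cos_angleIn_pos : 0 < Real.cos s.angleIn := cos_mul_fundAngle_pos s.a_le

theorem cos_angleOut_pos : 0 < Real.cos s.angleOut := cos_mul_fundAngle_pos s.c_le

theorem sin_angleOut_pos_or : 0 < Real.sin s.angleOut ∨ s.angleOut = 0 := by
  obtain h | h := Nat.eq_zero_or_pos s.c
  · exact .inr (by simp [angleOut, h])
  · exact .inl (sin_mul_fundAngle_pos h (by have := s.c_le; omega))

theorem angleIn_add_angleOut : s.angleIn + s.angleOut = (s.a + s.c : ℕ) * fundAngle n := by
  rw [angleIn, angleOut, Nat.cast_add, add_mul]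

theorem sin_angleIn_add_angleOut_pos : 0 < Real.sin (s.angleIn + s.angleOut) := by
  rw [angleIn_add_angleOut]
  have := s.one_le_a; have := s.a_le; have := s.c_le
  exact sin_mul_fundAngle_pos (by omega) (by omega)

theorem cos_angleIn_add_angleOut_pos (h : s.a + s.c ≤ n) :
    0 < Real.cos (s.angleIn + s.angleOut) := by
  rw [angleIn_add_angleOut]
  exact cos_mul_fundAngle_pos h

theorem cos_angleIn_add_angleOut_neg (h : s.IsAcute) :
    Real.cos (s.angleIn + s.angleOut) < 0 := by
  rw [angleIn_add_angleOut]
  have := s.a_le; have := s.c_le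
  exact cos_mul_fundAngle_neg h (by omega)

theorem shift_angles_pos : 0 < shift s.angleIn s.angleOut :=
  div_pos s.cos_angleOut_pos (mul_pos s.sin_angleIn_pos s.sin_angleIn_add_angleOut_pos)

/-- The standard seed with given parameters. -/
def seed (F : Frame) : LabelledSeed := F.standardSeed s.angleIn s.angleOut s.ε s.x

variable {F : Frame}

theorem form_seed_self (i : Fin 3) : ((s.seed F).v i).form ((s.seed F).v i) = 2 :=
  Frame.form_standardSeed_self i

theorem seed_mutate_mutate (k : Fin 3) :
    ((s.seed F).mutate F.pos k).mutate F.pos k = s.seed F :=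
  LabelledSeed.mutate_mutate (s.form_seed_self k) (Frame.neg_standardSeed_mem_pos
    s.sin_angleIn_pos s.cos_angleIn_pos s.cos_angleOut_pos s.sin_angleOut_pos_or k)

variable {s t} in
theorem mk_seed_mutate_symm {k : Fin 3} {σ : Equiv.Perm (Fin 3)}
    (h : (s.seed F).mutate F.pos k = (t.seed F).perm σ) :
    (⟦(t.seed F).mutate F.pos (σ k)⟧ : Seed) = ⟦s.seed F⟧ := by
  rw [← s.seed_mutate_mutate k, h, LabelledSeed.perm_mutate, LabelledSeed.mk_perm]

theorem seed_mutate_zero_of_le (h : s.a + s.c ≤ n) :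
    (s.seed F).mutate F.pos 0 = (s.mutIn.seed F).perm (Equiv.swap 0 1) := by
  rw [seed, Frame.standardSeed_mutate_zero_of_pos s.sin_angleIn_pos s.cos_angleOut_pos
    s.sin_angleIn_add_angleOut_pos (s.cos_angleIn_add_angleOut_pos h), angleIn_add_angleOut]
  simp only [mutIn, h, dif_pos, seed, angleIn, angleOut]

theorem seed_mutate_zero_of_isAcute (h : s.IsAcute) :
    (s.seed F).mutate F.pos 0 = (s.mutIn.seed F).perm (finRotate 3).symm := by
  have := s.a_le; have := s.c_le
  rw [seed, Frame.standardSeed_mutate_zero_of_neg s.sin_angleIn_pos s.cos_angleOut_pos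
    s.sin_angleIn_add_angleOut_pos (s.cos_angleIn_add_angleOut_neg h), angleIn_add_angleOut,
    ← sub_mul_fundAngle (by omega)]
  simp only [mutIn, not_le.2 h, dif_neg, not_false_eq_true, seed, angleIn, angleOut]

theorem seed_mutate_two_of_le (h : s.a + s.c ≤ n) :
    (s.seed F).mutate F.pos 2 = (s.mutOut.seed F).perm (Equiv.swap 1 2) := by
  rw [seed, Frame.standardSeed_mutate_two_of_pos s.sin_angleIn_pos s.cos_angleIn_pos
    (Frame.standardSeed_two_not_mem_pos s.sin_angleIn_pos s.cos_angleIn_pos s.sin_angleOut_pos_or)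
    (s.cos_angleIn_add_angleOut_pos h), angleIn_add_angleOut]
  simp only [mutOut, h, dif_pos, seed, angleIn, angleOut]

theorem mk_seed_mutate (k : Fin 3) :
    (⟦(s.seed F).mutate F.pos k⟧ : Seed) = ⟦(s.mutate k).seed F⟧ := by
  have := s.a_le; have := s.c_le; have := s.one_le_a
  fin_cases k
  · change (⟦(s.seed F).mutate F.pos 0⟧ : Seed) = ⟦s.mutIn.seed F⟧
    obtain h | h := le_or_gt (s.a + s.c) n
    · rw [s.seed_mutate_zero_of_le h, LabelledSeed.mk_perm]
    · rw [s.seed_mutate_zero_of_isAcute h, LabelledSeed.mk_perm]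
  · change (⟦(s.seed F).mutate F.pos 1⟧ : Seed) = ⟦s.mutMid.seed F⟧
    obtain h | h := le_or_gt s.a s.c
    · have e := s.mutMid.seed_mutate_two_of_le (F := F) (by simp only [mutMid, h, dif_pos]; omega)
      rw [mutOut_mutMid h] at e
      exact mk_seed_mutate_symm e
    · have e := s.mutMid.seed_mutate_zero_of_le (F := F) (by
        simp only [mutMid, h.not_ge, dif_neg, not_false_eq_true]; omega)
      rw [mutIn_mutMid h] at e
      exact mk_seed_mutate_symm e
  · change (⟦(s.seed F).mutate F.pos 2⟧ : Seed) = ⟦s.mutOut.seed F⟧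
    obtain h | h := le_or_gt (s.a + s.c) n
    · rw [s.seed_mutate_two_of_le h, LabelledSeed.mk_perm]
    · have e := s.mutOut.seed_mutate_zero_of_isAcute (F := F) (by
        simp only [IsAcute, mutOut, h.not_ge, dif_neg, not_false_eq_true]; omega)
      rw [mutIn_mutOut h] at e
      exact mk_seed_mutate_symm e

theorem seed_glide_one (r : ℝ) : (s.glide 1 r).seed F =
    (s.seed F).move (AffineIsometryEquiv.constVAdd ℝ Plane (F.vec r 0)) := by
  refine LabelledSeed.ext_sides ?_ ?_ ?_ rfl <;>
  · refine Eq.trans (congrArg F.coordFun ?_) (F.coordFun_translate ..).symm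
    simp only [sideCoords, Matrix.cons_val, glide, angleIn, angleOut, one_mul, Prod.mk.injEq,
      true_and]
    ring

theorem seed_glide_neg_one {L : AffineSubspace ℝ Plane} [Nonempty L] (hL : L = F.axis) :
    (s.glide (-1) 0).seed F = (s.seed F).move (EuclideanGeometry.reflection L) := by
  refine LabelledSeed.ext_sides ?_ ?_ ?_ rfl <;>
  · refine Eq.trans (congrArg F.coordFun ?_) (F.coordFun_reflect hL ..).symm
    simp [sideCoords, glide, angleIn, angleOut]

theorem mk_seed_glide_one (r : ℝ) :
    (⟦(s.glide 1 r).seed F⟧ : Seed) = Seed.translate (F.vec r 0) ⟦s.seed F⟧ :=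
  congrArg _ (s.seed_glide_one r)

theorem mk_seed_glide_neg_one {L : AffineSubspace ℝ Plane} [Nonempty L] (hL : L = F.axis) :
    (⟦(s.glide (-1) 0).seed F⟧ : Seed) =
      Seed.move (EuclideanGeometry.reflection L) ⟦s.seed F⟧ :=
  congrArg _ (s.seed_glide_neg_one hL)

variable {s t}

theorem perm_eq_one {σ : Equiv.Perm (Fin 3)}
    (hform : ∀ i j, ((t.seed F).v i).form ((t.seed F).v j) =
      ((s.seed F).v (σ i)).form ((s.seed F).v (σ j)))
    (hB : (t.seed F).B = (s.seed F).B.submatrix σ σ) : σ = 1 :=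
  Frame.standardSeed_perm_eq_one t.cos_angleIn_pos.ne' t.cos_angleOut_pos.ne' hform hB

theorem angles_eq_of_B_eq (hB : (t.seed F).B = (s.seed F).B) : t.a = s.a ∧ t.c = s.c := by
  have hC : 2 * Real.cos t.angleOut = 2 * Real.cos s.angleOut := congrFun₂ hB 0 1
  have hA : 2 * Real.cos t.angleIn = 2 * Real.cos s.angleIn := congrFun₂ hB 1 2
  have := s.a_le; have := s.c_le; have := t.a_le; have := t.c_le
  exact ⟨cos_mul_fundAngle_inj (by omega) (by omega) (mul_left_cancel₀ two_ne_zero hA),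
    cos_mul_fundAngle_inj (by omega) (by omega) (mul_left_cancel₀ two_ne_zero hC)⟩

theorem eq_glide_of_sides_eq {r d : ℝ} (ha : t.a = s.a) (hc : t.c = s.c)
    (h : ∀ i, (t.seed F).v i =
      ((s.seed F).v i).move (AffineIsometryEquiv.constVAdd ℝ Plane (F.vec r d))) :
    d = 0 ∧ t = s.glide 1 r := by
  have hA : t.angleIn = s.angleIn := by rw [angleIn, angleIn, ha]
  have hC : t.angleOut = s.angleOut := by rw [angleOut, angleOut, hc]
  have h0 := F.coordFun_injective ((h 0).trans (F.coordFun_translate ..))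
  have h2 := F.coordFun_injective ((h 2).trans (F.coordFun_translate ..))
  simp only [sideCoords, Matrix.cons_val, hA, hC, Prod.mk.injEq, true_and] at h0 h2
  obtain ⟨hε, h0⟩ := h0
  have hε : t.ε = s.ε := by exact_mod_cast mul_right_cancel₀ s.cos_angleIn_pos.ne' hε
  have hx : t.x = s.x + r := by
    have hS := s.sin_angleIn_add_angleOut_pos.ne'
    rw [Real.sin_add] at hS
    refine sub_eq_zero.1 ((mul_eq_zero.1 ?_).resolve_right hS)
    linear_combination Real.cos s.angleOut * h0 - Real.cos s.angleIn * h2.2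
  refine ⟨?_, by ext <;> simp [glide, ha, hc, hε, hx]⟩
  have hd : d * ((s.ε : ℤ) * Real.cos s.angleIn) = 0 := by rw [hx] at h0; linarith
  exact (mul_eq_zero.1 hd).resolve_right
    (mul_ne_zero (by exact_mod_cast s.ε.ne_zero) s.cos_angleIn_pos.ne')

theorem eq_glide_of_translate {w : Plane}
    (h : (⟦t.seed F⟧ : Seed) = Seed.translate w ⟦s.seed F⟧) :
    ∃ r : ℝ, w = F.vec r 0 ∧ t = s.glide 1 r := by
  obtain ⟨σ, hσ⟩ := LabelledSeed.mk_eq_iff.1 h.symm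
  have hv (i : Fin 3) : (t.seed F).v i =
      ((s.seed F).v (σ i)).move (AffineIsometryEquiv.constVAdd ℝ Plane w) := by rw [hσ]; rfl
  have hB : (t.seed F).B = (s.seed F).B.submatrix σ σ := by rw [hσ]; rfl
  obtain rfl : σ = 1 := perm_eq_one (fun i j => by rw [hv, hv, AffFun.form_move]) hB
  obtain ⟨ha, hc⟩ := angles_eq_of_B_eq hB
  obtain ⟨r, d, rfl⟩ := F.exists_vec w
  obtain ⟨rfl, ht⟩ := eq_glide_of_sides_eq ha hc hv
  exact ⟨r, rfl, ht⟩

theorem mk_seed_injective (F : Frame) :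
    Function.Injective fun s : SeedParams n => (⟦s.seed F⟧ : Seed) := by
  intro t s h
  obtain ⟨r, hr, rfl⟩ := eq_glide_of_translate (h.trans
    ((congrArg (fun u : SeedParams n => (⟦u.seed F⟧ : Seed)) s.glide_one_zero).symm.trans
      (s.mk_seed_glide_one 0)))
  have := congrArg norm hr
  rw [F.norm_vec_zero_right, F.norm_vec_zero_right, abs_zero] at this
  obtain rfl : r = 0 := by simpa [F.unit_pos.ne'] using this.symm
  exact s.glide_one_zero

end SeedParams

/-! ### Mutation classes of parameters -/

namespace SeedParams

variable {n : ℕ} {o s t : SeedParams n} {a c : ℕ} {r : ℝ} {δ : ℤˣ}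

theorem IsAcute.mutIn_a (h : s.IsAcute) : s.mutIn.a = 2 * n + 1 - (s.a + s.c) := by
  simp only [SeedParams.mutIn, not_le.2 h, dif_neg, not_false_eq_true]

theorem IsAcute.mutIn_c (h : s.IsAcute) : s.mutIn.c = s.a := by
  simp only [SeedParams.mutIn, not_le.2 h, dif_neg, not_false_eq_true]

theorem IsAcute.mutIn_ε (h : s.IsAcute) : s.mutIn.ε = -s.ε := by
  simp only [SeedParams.mutIn, not_le.2 h, dif_neg, not_false_eq_true]

theorem IsAcute.mutOut_a (h : s.IsAcute) : s.mutOut.a = s.c := by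
  simp only [SeedParams.mutOut, not_le.2 h, dif_neg, not_false_eq_true]

theorem IsAcute.mutOut_c (h : s.IsAcute) : s.mutOut.c = 2 * n + 1 - (s.a + s.c) := by
  simp only [SeedParams.mutOut, not_le.2 h, dif_neg, not_false_eq_true]

theorem IsAcute.mutIn (h : s.IsAcute) : s.mutIn.IsAcute := by
  rw [IsAcute, h.mutIn_a, h.mutIn_c]
  have := s.c_le
  omega

theorem IsAcute.mutOut (h : s.IsAcute) : s.mutOut.IsAcute := by
  rw [IsAcute, h.mutOut_a, h.mutOut_c]
  have := s.a_le
  omega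

theorem IsAcute.mutIn_mutIn_mutIn (h : s.IsAcute) :
    ∃ r, s.mutIn.mutIn.mutIn = s.glide (-1) r := by
  have h' := h.mutIn.mutIn
  refine ⟨s.mutIn.mutIn.mutIn.x - s.x, SeedParams.ext ?_ ?_ ?_ (add_sub_cancel ..).symm⟩
  · rw [h'.mutIn_a, h.mutIn.mutIn_a, h.mutIn.mutIn_c, h.mutIn_a, h.mutIn_c]
    change _ = s.a
    unfold IsAcute at h
    have := s.a_le; have := s.c_le
    omega
  · rw [h'.mutIn_c, h.mutIn.mutIn_a, h.mutIn_a, h.mutIn_c]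
    change _ = s.c
    unfold IsAcute at h
    have := s.a_le; have := s.c_le
    omega
  · simp [h'.mutIn_ε, h.mutIn.mutIn_ε, h.mutIn_ε, glide]

/-- The relation generated by mutations, which is symmetric as each mutation is an involution. -/
def MutationEquiv : SeedParams n → SeedParams n → Prop :=
  Relation.ReflTransGen fun s t => ∃ k, t = s.mutate k

namespace MutationEquiv

theorem refl (s : SeedParams n) : s.MutationEquiv s := Relation.ReflTransGen.refl

theorem trans (h : o.MutationEquiv s) (h' : s.MutationEquiv t) : o.MutationEquiv t :=
  Relation.ReflTransGen.trans h h'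

theorem mutate (h : o.MutationEquiv s) (k : Fin 3) : o.MutationEquiv (s.mutate k) :=
  Relation.ReflTransGen.tail h ⟨k, rfl⟩

theorem symm (h : s.MutationEquiv t) : t.MutationEquiv s := by
  induction h with
  | refl => exact .refl _
  | @tail y z _ hyz ih =>
    obtain ⟨k, rfl⟩ := hyz
    obtain ⟨l, hl⟩ := exists_mutate_mutate y k
    exact .head ⟨l, hl.symm⟩ ih

theorem glide (h : s.MutationEquiv t) (δ : ℤˣ) (r : ℝ) :
    (s.glide δ r).MutationEquiv (t.glide δ r) := by
  induction h with
  | refl => exact .refl _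
  | tail _ hyz ih =>
    obtain ⟨k, rfl⟩ := hyz
    exact ih.tail ⟨k, (mutate_glide _ δ r k).symm⟩

theorem glide_of_glide (hs : o.MutationEquiv s) (h : o.MutationEquiv (s.glide δ r))
    (ht : o.MutationEquiv t) : o.MutationEquiv (t.glide δ r) :=
  h.trans ((hs.symm.trans ht).glide δ r)

end MutationEquiv

/-- Parameters with the angles `a` and `c` can be reached from `o`. -/
def Reaches (o : SeedParams n) (a c : ℕ) : Prop := ∃ t, o.MutationEquiv t ∧ t.a = a ∧ t.c = c

theorem reaches_add_right (ha : 1 ≤ a) (h : a + c ≤ n) : o.Reaches a (a + c) ↔ o.Reaches a c := by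
  constructor
  · rintro ⟨t, ht, rfl, hc⟩
    have hle : t.a ≤ t.c := by omega
    exact ⟨t.mutMid, ht.mutate 1, by simp [mutMid, hle], by simp [mutMid, hc]⟩
  · rintro ⟨t, ht, rfl, rfl⟩
    exact ⟨t.mutOut, ht.mutate 2, by simp [mutOut, h], by simp [mutOut, h]⟩

theorem reaches_add_left (ha : 1 ≤ a) (h : a + c ≤ n) : o.Reaches (a + c) c ↔ o.Reaches a c := by
  constructor
  · rintro ⟨t, ht, hta, rfl⟩
    have hlt : ¬t.a ≤ t.c := by omega
    exact ⟨t.mutMid, ht.mutate 1, by simp [mutMid, hlt]; omega, by simp [mutMid, hlt]⟩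
  · rintro ⟨t, ht, rfl, rfl⟩
    exact ⟨t.mutIn, ht.mutate 0, by simp [mutIn, h], by simp [mutIn, h]⟩

theorem Reaches.mutOut (h : o.Reaches a c) (hacute : n < a + c) :
    o.Reaches c (2 * n + 1 - (a + c)) := by
  obtain ⟨t, ht, rfl, rfl⟩ := h
  exact ⟨t.mutOut, ht.mutate 2, IsAcute.mutOut_a hacute, IsAcute.mutOut_c hacute⟩

theorem reaches_iff_gcd {a c : ℕ} (ha : 1 ≤ a) (han : a ≤ n) (hcn : c ≤ n) :
    o.Reaches a c ↔ o.Reaches (a.gcd c) 0 := by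
  obtain rfl | hc := Nat.eq_zero_or_pos c
  · rw [Nat.gcd_zero_right]
  obtain h | h := le_or_gt a c
  · obtain ⟨c, rfl⟩ := Nat.exists_eq_add_of_le h
    rw [reaches_add_right ha hcn, reaches_iff_gcd ha han (by omega), Nat.gcd_self_add_right]
  · obtain ⟨a, rfl⟩ := Nat.exists_eq_add_of_le' h.le
    rw [reaches_add_left (by omega) han, reaches_iff_gcd (by omega) (by omega) hcn,
      Nat.gcd_add_self_left]
termination_by a + c

/-- With `g = gcd a c` and `k = n / g`, mutating the acute-angled triangle with the angles `g`,
`k * g` and `b = 2 * n + 1 - (k + 1) * g` exchanges the pair `(g, k * g)` for the coprime pair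
`(b, g)`. -/
theorem reaches_of_gcd_eq_one (ho : o.a.gcd o.c = 1) (ha : 1 ≤ a) (han : a ≤ n) (hcn : c ≤ n)
    (h : (a.gcd c).gcd (2 * n + 1) = 1) : o.Reaches a c := by
  have h1 : o.Reaches 1 0 := by
    rw [← ho, ← reaches_iff_gcd o.one_le_a o.a_le o.c_le]
    exact ⟨o, .refl o, rfl, rfl⟩
  rw [reaches_iff_gcd ha han hcn]
  set g := a.gcd c
  have hg : 1 ≤ g := Nat.gcd_pos_of_pos_left _ ha
  have hgn : g ≤ n := (Nat.gcd_le_left _ ha).trans han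
  have hk : n / g * g ≤ n := Nat.div_mul_le_self n g
  have hk' : n < n / g * g + g := Nat.lt_div_mul_add hg
  obtain ⟨b, hb⟩ : ∃ b, b + (n / g * g + g) = 2 * n + 1 := ⟨_, Nat.sub_add_cancel (by omega)⟩
  have hbg : b.gcd g = 1 := by
    rw [← h, Nat.gcd_comm, ← Nat.gcd_add_mul_right_right g b (n / g + 1)]
    congr 1
    rw [add_mul, one_mul]
    omega
  have hbr : o.Reaches b g := by
    rwa [reaches_iff_gcd (by omega) (by omega) hgn, hbg]
  have hgk : o.Reaches g (n / g * g) := by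
    convert hbr.mutOut (by omega) using 1
    omega
  rwa [reaches_iff_gcd hg hgn hk, Nat.gcd_mul_left_right] at hgk

/-- The translations along the belt line that preserve the mutation class of `o`. -/
def period (o : SeedParams n) : AddSubgroup ℝ where
  carrier := {r | o.MutationEquiv (o.glide 1 r)}
  zero_mem' := by
    rw [Set.mem_ofPred_eq, glide_one_zero]
    exact .refl o
  add_mem' {r r'} h h' := by
    simpa only [Set.mem_ofPred_eq, glide_glide, one_mul] using
      (MutationEquiv.refl o).glide_of_glide h' h
  neg_mem' {r} h := by
    simpa only [Set.mem_ofPred_eq, glide_glide, one_mul, add_neg_cancel, glide_one_zero] using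
      (MutationEquiv.symm h).glide 1 (-r)

theorem mem_period (h : o.MutationEquiv s) : r ∈ o.period ↔ o.MutationEquiv (s.glide 1 r) :=
  ⟨fun hr => (MutationEquiv.refl o).glide_of_glide hr h, fun hr => h.glide_of_glide hr (.refl o)⟩

theorem add_self_mem_period (h : o.MutationEquiv (o.glide (-1) r)) : r + r ∈ o.period := by
  have := (MutationEquiv.refl o).glide_of_glide h h
  rwa [glide_glide, neg_mul_neg, one_mul] at this

theorem exists_glide_of_same_angles {y : ℝ} (hy : o.MutationEquiv (o.glide (-1) y))
    (hs : o.MutationEquiv s) (ht : o.MutationEquiv t) (ha : t.a = s.a) (hc : t.c = s.c) :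
    ∃ r ∈ o.period, t = s.glide 1 r ∨ t = s.glide (-1) (y + r) := by
  obtain ⟨δ, hδ⟩ : ∃ δ : ℤˣ, t.ε = δ * s.ε := ⟨t.ε * s.ε⁻¹, (inv_mul_cancel_right ..).symm⟩
  have e : t = s.glide δ (t.x - s.x) := by ext <;> simp [glide, ha, hc, hδ]
  obtain rfl | rfl := Int.units_eq_one_or δ
  · exact ⟨t.x - s.x, (mem_period hs).2 (e ▸ ht), .inl e⟩
  · have ho : o.MutationEquiv (o.glide (-1) (t.x - s.x)) := hs.glide_of_glide (e ▸ ht) (.refl o)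
    refine ⟨t.x - s.x - y, (mem_period hy).2 ?_, .inr (by rwa [add_sub_cancel])⟩
    rwa [glide_glide, mul_one, add_sub_cancel]

end SeedParams

/-! ### Congruence -/

theorem exists_eval_eq {ℓ : AffFun →ₗ[ℝ] ℝ} (hℓ : ℓ (0, 1) = 1) :
    ∃ p, ∀ f : AffFun, ℓ f = f.eval p := by
  refine ⟨(InnerProductSpace.toDual ℝ Plane).symm
    (ℓ ∘ₗ LinearMap.inl ℝ Plane ℝ).toContinuousLinearMap, fun f => ?_⟩
  have hf : f = (f.1, 0) + f.2 • (0, 1) := by simp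
  rw [AffFun.eval, real_inner_comm, InnerProductSpace.toDual_symm_apply]
  conv_lhs => rw [hf, map_add, map_smul, hℓ]
  simp

theorem exists_move_eq {Φ : AffFun →ₗ[ℝ] AffFun} (hform : ∀ f g, (Φ f).form (Φ g) = f.form g)
    (hΦ : Φ (0, 1) = (0, 1)) : ∃ φ : Plane ≃ᵃⁱ[ℝ] Plane, ∀ f, Φ f = f.move φ := by
  obtain ⟨p, hp⟩ := exists_eval_eq (ℓ := LinearMap.snd ℝ Plane ℝ ∘ₗ Φ) (congrArg Prod.snd hΦ)
  let T : Plane ≃ₗᵢ[ℝ] Plane :=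
    ((LinearMap.fst ℝ Plane ℝ ∘ₗ Φ ∘ₗ LinearMap.inl ℝ Plane ℝ).isometryOfInner
      fun x y => hform (x, 0) (y, 0)).toLinearIsometryEquiv rfl
  have hT (f : AffFun) : T f.1 = (Φ f).1 := by
    have hf : f = (f.1, 0) + f.2 • (0, 1) := by simp
    calc T f.1 = (Φ (f.1, 0)).1 := rfl
      _ = (Φ f).1 := by conv_rhs => rw [hf, map_add, map_smul, hΦ]; simp
  let φ := (AffineIsometryEquiv.constVAdd ℝ Plane (-p)).trans T.toAffineIsometryEquiv
  have hφ : φ.symm 0 = p := by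
    rw [← φ.symm_apply_apply p]
    simp [φ]
  refine ⟨φ, fun f => Prod.ext (hT f).symm ?_⟩
  rw [AffFun.move, hφ]
  exact hp f

/-- A basis of the three-dimensional space of affine functions. -/
def basisOfAffFun {v : Fin 3 → AffFun} (hv : LinearIndependent ℝ v) :
    Module.Basis (Fin 3) ℝ AffFun :=
  basisOfLinearIndependentOfCardEqFinrank hv (by simp)

section

variable {v v' : Fin 3 → AffFun} {c : Fin 3 → ℝ} {κ : ℝ}

theorem areCongruent_of_form_eq (hv : LinearIndependent ℝ v')
    (hform : ∀ i j, (v i).form (v j) = (v' i).form (v' j)) (hκ : κ ≠ 0)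
    (hsum : ∑ i, c i • v i = (0, κ)) (hsum' : ∑ i, c i • v' i = (0, κ)) :
    AreCongruent v v' := by
  let b := basisOfAffFun hv
  have hb (i : Fin 3) : b i = v' i := by simp [b, basisOfAffFun]
  let Φ := b.constr ℝ v
  have hΦ (i : Fin 3) : Φ (v' i) = v i := by rw [← hb, b.constr_basis]
  have hΦform (f g : AffFun) : (Φ f).form (Φ g) = f.form g := by
    let Q : LinearMap.BilinForm ℝ AffFun :=
      (innerₗ Plane).compl₁₂ (LinearMap.fst ℝ Plane ℝ) (LinearMap.fst ℝ Plane ℝ)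
    have hQ : Q.compl₁₂ Φ Φ = Q := LinearMap.BilinForm.ext_basis b fun i j => by
      rw [hb, hb, LinearMap.compl₁₂_apply, hΦ, hΦ]
      exact hform i j
    exact LinearMap.congr_fun₂ hQ f g
  have hΦone : Φ (0, 1) = (0, 1) := by
    have h : Φ (0, κ) = (0, κ) := by simp only [← hsum', map_sum, map_smul, hΦ, hsum]
    have hκ' : ((0, 1) : AffFun) = κ⁻¹ • (0, κ) := by simp [hκ]
    rw [hκ', map_smul, h]
  obtain ⟨φ, hφ⟩ := exists_move_eq hΦform hΦone
  exact ⟨φ, fun i => by rw [← hφ, hΦ]⟩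

/-- The point found here is the incenter. -/
theorem domain_nonempty_of_sum (hv : LinearIndependent ℝ v) (hc : 0 < ∑ i, c i) (hκ : κ < 0)
    (hsum : ∑ i, c i • v i = (0, κ)) : (domain v).Nonempty := by
  let b := basisOfAffFun hv
  let ℓ := b.constr ℝ fun _ => κ / ∑ i, c i
  have hℓ (i : Fin 3) : ℓ (v i) = κ / ∑ i, c i := by
    rw [← b.constr_basis ℝ (fun _ => κ / ∑ i, c i) i]
    simp [ℓ, b, basisOfAffFun]
  have h : ℓ (0, κ) = κ := by
    simp only [← hsum, map_sum, map_smul, hℓ, smul_eq_mul, ← Finset.sum_mul]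
    exact mul_div_cancel₀ κ hc.ne'
  obtain ⟨p, hp⟩ := exists_eval_eq (ℓ := ℓ) (by
    have hκ' : ((0, 1) : AffFun) = κ⁻¹ • (0, κ) := by simp [hκ.ne]
    rw [hκ', map_smul, h, smul_eq_mul, inv_mul_cancel₀ hκ.ne])
  refine ⟨p, Set.mem_iInter.2 fun i => ?_⟩
  change (v i).eval p < 0
  rw [← hp, hℓ]
  exact div_neg_of_neg_of_pos hκ hc

theorem AreCongruent.form_eq (h : AreCongruent v v') (i j : Fin 3) :
    (v i).form (v j) = (v' i).form (v' j) := by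
  obtain ⟨φ, hφ⟩ := h
  rw [hφ, hφ, AffFun.form_move]

end

theorem pi_sub_angle_eq {f g : AffFun} {θ : ℝ} (hf : f.form f = 2) (hg : g.form g = 2)
    (hfg : f.form g = -(2 * Real.cos θ)) (hθ : 0 ≤ θ) (hπ : θ ≤ Real.pi) :
    Real.pi - InnerProductGeometry.angle f.1 g.1 = θ := by
  have hf' : ‖f.1‖ = √2 := by rw [norm_eq_sqrt_real_inner, ← hf, AffFun.form]
  have hg' : ‖g.1‖ = √2 := by rw [norm_eq_sqrt_real_inner, ← hg, AffFun.form]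
  rw [InnerProductGeometry.angle, hf', hg', Real.mul_self_sqrt zero_le_two, ← AffFun.form, hfg,
    neg_div, mul_div_cancel_left₀ _ two_ne_zero, Real.arccos_neg, Real.arccos_cos hθ hπ,
    sub_sub_cancel]

theorem domain_comp (v : Fin 3 → AffFun) (σ : Equiv.Perm (Fin 3)) : domain (v ∘ σ) = domain v :=
  σ.surjective.iInter_comp fun i => (v i).halfPlane

/-! ### The angles of standard seeds -/

theorem linearIndependent_sideCoords {A C x : ℝ} {ε : ℤˣ} (hA : Real.sin A ≠ 0) :
    LinearIndependent ℝ (sideCoords A C ε x) := by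
  refine Fintype.linearIndependent_iff.2 fun g hg => ?_
  simp only [Fin.sum_univ_three, sideCoords, Matrix.cons_val, Prod.smul_mk, Prod.mk_add_mk,
    smul_eq_mul, Prod.mk_eq_zero] at hg
  obtain ⟨h1, h2, h3⟩ := hg
  have hsin : -(g 1 * Real.sin C) + g 2 * Real.sin (A + C) = 0 := by
    have e := Real.sin_sub (A - C) A
    rw [sub_sub_cancel_left, Real.sin_neg] at e
    rw [Real.sin_add]
    linear_combination Real.cos A * h1 + ε * Real.sin A * h2 + g 1 * e - (g 0 * Real.cos A -
      g 1 * Real.cos (A - C) + g 2 * Real.cos C) * Real.sin A * intUnit_sq ε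
  have hcos : -(g 1 * Real.cos C) + g 2 * Real.cos (A + C) = 0 := by
    field_simp at h3
    linear_combination h3 + x * Real.sin A * h1
  have hA' : Real.sin (A + C) * Real.cos C - Real.cos (A + C) * Real.sin C = Real.sin A := by
    rw [← Real.sin_sub, add_sub_cancel_right]
  have hg1 : g 1 = 0 := (mul_eq_zero.1 (show g 1 * Real.sin A = 0 by
    linear_combination Real.cos (A + C) * hsin - Real.sin (A + C) * hcos - g 1 * hA')).resolve_right
      hA
  have hg2 : g 2 = 0 := (mul_eq_zero.1 (show g 2 * Real.sin A = 0 by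
    linear_combination Real.cos C * hsin - Real.sin C * hcos - g 2 * hA')).resolve_right hA
  have hg0 : g 0 = 0 := (mul_eq_zero.1 (show g 0 * Real.sin A = 0 by
    linear_combination -h1 + Real.sin (A - C) * hg1 + Real.sin C * hg2)).resolve_right hA
  intro i
  fin_cases i <;> assumption

namespace SeedParams

variable {n : ℕ} {F : Frame} (s : SeedParams n) {t : SeedParams n} {m : Fin 3 → ℕ}
  {σ τ : Equiv.Perm (Fin 3)}

/-- The angles opposite to the sides of a standard seed, in fundamental angles. -/
def angles : Fin 3 → ℕ := ![s.a, 2 * n + 1 - (s.a + s.c), s.c]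

theorem a_add_c_le : s.a + s.c ≤ 2 * n + 1 := by
  have := s.a_le; have := s.c_le; omega

theorem angles_le (i : Fin 3) : s.angles i ≤ 2 * n + 1 := by
  have := s.a_add_c_le
  fin_cases i
  exacts [le_trans (Nat.le_add_right ..) this, tsub_le_self, le_trans (Nat.le_add_left ..) this]

theorem angles_one_mul_fundAngle :
    s.angles 1 * fundAngle n = Real.pi - (s.angleIn + s.angleOut) := by
  rw [angleIn_add_angleOut, ← sub_mul_fundAngle s.a_add_c_le]
  rfl

theorem form_seed_of_ne {i j k : Fin 3} (hij : i ≠ j) (hjk : j ≠ k) (hik : i ≠ k) :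
    ((s.seed F).v i).form ((s.seed F).v j) = -(2 * Real.cos (s.angles k * fundAngle n)) := by
  have h01 : ((s.seed F).v 0).form ((s.seed F).v 1) =
      -(2 * Real.cos (s.angles 2 * fundAngle n)) := Frame.form_standardSeed_zero_one
  have h02 : ((s.seed F).v 0).form ((s.seed F).v 2) =
      -(2 * Real.cos (s.angles 1 * fundAngle n)) := by
    rw [angles_one_mul_fundAngle, Real.cos_pi_sub, mul_neg, neg_neg]
    exact Frame.form_standardSeed_zero_two
  have h12 : ((s.seed F).v 1).form ((s.seed F).v 2) =
      -(2 * Real.cos (s.angles 0 * fundAngle n)) := Frame.form_standardSeed_one_two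
  wlog h : i < j generalizing i j
  · rw [AffFun.form_comm]
    exact this hij.symm hik hjk (hij.lt_or_gt.resolve_left h)
  have key : ∀ i j k : Fin 3, i < j → j ≠ k → i ≠ k →
      i = 0 ∧ j = 1 ∧ k = 2 ∨ i = 0 ∧ j = 2 ∧ k = 1 ∨ i = 1 ∧ j = 2 ∧ k = 0 := by decide
  obtain ⟨rfl, rfl, rfl⟩ | ⟨rfl, rfl, rfl⟩ | ⟨rfl, rfl, rfl⟩ := key i j k h hjk hik
  exacts [h01, h02, h12]

theorem sum_sin_smul_seed :
    ∑ i, Real.sin (s.angles i * fundAngle n) • (s.seed F).v i = (0, -(√2 * F.unit)) := by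
  have h := congrArg F.coordFun (sum_sin_smul_sideCoords (C := s.angleOut) (ε := s.ε) (x := s.x)
    s.sin_angleIn_pos.ne')
  simp only [map_add, map_smul] at h
  rw [Fin.sum_univ_three, angles_one_mul_fundAngle, Real.sin_pi_sub]
  exact h.trans (by simp [Frame.coordFun])

theorem linearIndependent_seed : LinearIndependent ℝ (s.seed F).v :=
  (linearIndependent_sideCoords s.sin_angleIn_pos.ne').map' F.coordFun
    (LinearMap.ker_eq_bot.2 F.coordFun_injective)

theorem neg_sqrt_two_mul_unit_neg (F : Frame) : -(√2 * F.unit) < 0 :=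
  neg_neg_of_pos (mul_pos (by positivity) F.unit_pos)

theorem domain_seed_nonempty : (domain (s.seed F).v).Nonempty := by
  refine domain_nonempty_of_sum s.linearIndependent_seed ?_ (neg_sqrt_two_mul_unit_neg F)
    s.sum_sin_smul_seed
  refine Finset.sum_pos' (fun i _ => ?_) ⟨0, Finset.mem_univ 0, s.sin_angleIn_pos⟩
  exact Real.sin_nonneg_of_nonneg_of_le_pi (mul_fundAngle_nonneg _ _)
    (mul_fundAngle_le_pi (s.angles_le i))

theorem form_seed_perm (i : Fin 3) :
    (((s.seed F).perm σ).v (i + 1)).form (((s.seed F).perm σ).v (i + 2)) =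
      -(2 * Real.cos (s.angles (σ i) * fundAngle n)) := by
  have hne : ∀ i : Fin 3, i + 1 ≠ i + 2 ∧ i + 2 ≠ i ∧ i + 1 ≠ i := by decide
  obtain ⟨h1, h2, h3⟩ := hne i
  exact s.form_seed_of_ne (σ.injective.ne h1) (σ.injective.ne h2) (σ.injective.ne h3)

theorem hasAngles_seed_perm_iff :
    HasAngles ((s.seed F).perm σ).v (fun i => m i * fundAngle n) ↔ ∀ i, s.angles (σ i) = m i := by
  have hdom : (domain ((s.seed F).perm σ).v).Nonempty := by
    rw [LabelledSeed.perm, domain_comp]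
    exact s.domain_seed_nonempty
  rw [HasAngles, and_iff_right hdom]
  refine forall_congr' fun i => ?_
  have h : Real.pi - InnerProductGeometry.angle (((s.seed F).perm σ).v (i + 1)).1
      (((s.seed F).perm σ).v (i + 2)).1 = s.angles (σ i) * fundAngle n :=
    pi_sub_angle_eq (s.form_seed_self _) (s.form_seed_self _) (s.form_seed_perm i)
      (mul_fundAngle_nonneg _ _) (mul_fundAngle_le_pi (s.angles_le _))
  rw [h, mul_left_inj' (fundAngle_pos n).ne', Nat.cast_inj]

variable {s}

theorem areCongruent_seed_perm (hs : ∀ i, s.angles (σ i) = m i)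
    (ht : ∀ i, t.angles (τ i) = m i) :
    AreCongruent ((s.seed F).perm σ).v ((t.seed F).perm τ).v := by
  have hsum {s : SeedParams n} {σ : Equiv.Perm (Fin 3)} (hs : ∀ i, s.angles (σ i) = m i) :
      ∑ i, Real.sin (m i * fundAngle n) • ((s.seed F).perm σ).v i = (0, -(√2 * F.unit)) := by
    simp only [← hs, ← s.sum_sin_smul_seed]
    exact Equiv.sum_comp σ fun i => Real.sin (s.angles i * fundAngle n) • (s.seed F).v i
  refine areCongruent_of_form_eq (t.linearIndependent_seed.comp τ τ.injective) (fun i j => ?_)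
    (neg_sqrt_two_mul_unit_neg F).ne (hsum hs) (hsum ht)
  obtain rfl | hij := eq_or_ne i j
  · exact (s.form_seed_self _).trans (t.form_seed_self _).symm
  · obtain ⟨k, hjk, hik⟩ : ∃ k, j ≠ k ∧ i ≠ k := by decide +revert
    have e := (hs k).trans (ht k).symm
    exact (s.form_seed_of_ne (σ.injective.ne hij) (σ.injective.ne hjk) (σ.injective.ne hik)).trans
      ((t.form_seed_of_ne (τ.injective.ne hij) (τ.injective.ne hjk) (τ.injective.ne hik)).trans
        (by rw [e])).symm

end SeedParams

/-! ### Acyclic and cyclic quivers -/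

section Quiver

variable {B : Matrix (Fin 3) (Fin 3) ℝ} {ρ : Equiv.Perm (Fin 3)}

theorem IsAcyclic.submatrix (h : IsAcyclic B) (f : Fin 3 → Fin 3) : IsAcyclic (B.submatrix f f) :=
  fun i hi => h (f i) (hi.lift f fun _ _ hij => hij)

theorem isAcyclic_of_lt {ι : Type*} [Preorder ι] (f : Fin 3 → ι)
    (h : ∀ i j, 0 < B i j → f i < f j) : IsAcyclic B := fun i hi => by
  have hlt : Relation.TransGen (· < ·) (f i) (f i) := hi.lift f h
  rw [Relation.transGen_eq_self] at hlt
  exact lt_irrefl _ hlt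

theorem apply_self_eq_zero_of_skew (hB : ∀ i j, B j i = -B i j) (i : Fin 3) : B i i = 0 :=
  self_eq_neg.1 (hB i i)

theorem isAcyclic_iff_of_path (hB : ∀ i j, B j i = -B i j) (h01 : 0 < B (ρ 0) (ρ 1))
    (h12 : 0 < B (ρ 1) (ρ 2)) (h02 : B (ρ 0) (ρ 2) ≠ 0) : IsAcyclic B ↔ 0 < B (ρ 0) (ρ 2) := by
  refine ⟨fun h => h02.lt_or_gt.resolve_left fun h' => h (ρ 0) ?_, fun h => ?_⟩
  · have h20 : 0 < B (ρ 2) (ρ 0) := by rw [hB (ρ 0)]; exact neg_pos.2 h'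
    exact .tail (.tail (.single h01) h12) h20
  · have hle (i j : Fin 3) (hij : i ≤ j) : 0 ≤ B (ρ i) (ρ j) := by
      have h0 := apply_self_eq_zero_of_skew hB
      fin_cases i <;> fin_cases j <;> first
        | exact (h0 _).ge | exact h01.le | exact h12.le | exact h.le | exact absurd hij (by decide)
    refine isAcyclic_of_lt ρ.symm fun i j hij => lt_of_not_ge fun hji => ?_
    have := hle _ _ hji
    rw [ρ.apply_symm_apply, ρ.apply_symm_apply, hB i j] at this
    linarith

theorem exists_path (hB : ∀ i j, B j i = -B i j) (h0 : ∀ i j, i ≠ j → B i j ≠ 0) :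
    ∃ ρ : Equiv.Perm (Fin 3), 0 < B (ρ 0) (ρ 1) ∧ 0 < B (ρ 1) (ρ 2) := by
  have htot (i j : Fin 3) (h : i ≠ j) : 0 < B i j ∨ 0 < B j i := by
    rw [hB i j, neg_pos]
    exact (h0 i j h).symm.lt_or_gt
  obtain h01 | h10 := htot 0 1 (by decide)
  · obtain h12 | h21 := htot 1 2 (by decide)
    · exact ⟨1, h01, h12⟩
    · obtain h02 | h20 := htot 0 2 (by decide)
      exacts [⟨Equiv.swap 1 2, h02, h21⟩, ⟨(finRotate 3).symm, h20, h01⟩]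
  · obtain h02 | h20 := htot 0 2 (by decide)
    · exact ⟨Equiv.swap 0 1, h10, h02⟩
    · obtain h12 | h21 := htot 1 2 (by decide)
      exacts [⟨finRotate 3, h12, h20⟩, ⟨Equiv.swap 0 2, h21, h10⟩]

theorem exists_path_through (hB : ∀ i j, B j i = -B i j) (h0 : ∀ i j, i ≠ j → B i j ≠ 0)
    (hcyc : ¬ IsAcyclic B) (j : Fin 3) : ∃ ρ : Equiv.Perm (Fin 3), ρ 1 = j ∧
      0 < B (ρ 0) (ρ 1) ∧ 0 < B (ρ 1) (ρ 2) ∧ B (ρ 0) (ρ 2) < 0 := by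
  obtain ⟨ρ, h01, h12⟩ := exists_path hB h0
  have h02 := h0 _ _ (ρ.injective.ne (show (0 : Fin 3) ≠ 2 by decide))
  have h20 : B (ρ 0) (ρ 2) < 0 :=
    h02.lt_or_gt.resolve_right (mt (isAcyclic_iff_of_path hB h01 h12 h02).2 hcyc)
  rw [hB (ρ 2), neg_neg_iff_pos] at h20
  have hsucc (i : Fin 3) : 0 < B (ρ i) (ρ (i + 1)) := by
    fin_cases i
    exacts [h01, h12, h20]
  have hd : ∀ d : Fin 3, 1 + d = 0 + d + 1 ∧ 2 + d = 1 + d + 1 ∧ 0 + d = 2 + d + 1 := by decide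
  obtain ⟨d1, d2, d0⟩ := hd (ρ.symm j - 1)
  refine ⟨(Equiv.addRight (ρ.symm j - 1)).trans ρ, by simp, ?_, ?_, ?_⟩
  · exact (hsucc _).trans_eq (by rw [← d1]; rfl)
  · exact (hsucc _).trans_eq (by rw [← d2]; rfl)
  · rw [hB (((Equiv.addRight _).trans ρ) 2), neg_neg_iff_pos]
    exact (hsucc _).trans_eq (by rw [← d0]; rfl)

theorem eq_skewMatrix (hB : ∀ i j, B j i = -B i j) :
    B = skewMatrix (B 0 1) (B 1 2) (B 0 2) := by
  have h0 := apply_self_eq_zero_of_skew hB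
  ext i j
  fin_cases i <;> fin_cases j
  exacts [h0 0, rfl, rfl, hB 0 1, h0 1, rfl, hB 0 2, hB 1 2, h0 2]

end Quiver

namespace SeedParams

variable {n : ℕ} {F : Frame} (s : SeedParams n)

theorem seed_B_zero_one_pos : 0 < (s.seed F).B 0 1 := mul_pos two_pos s.cos_angleOut_pos

theorem seed_B_one_two_pos : 0 < (s.seed F).B 1 2 := mul_pos two_pos s.cos_angleIn_pos

theorem seed_B_zero_two_pos_iff : 0 < (s.seed F).B 0 2 ↔ s.IsAcute := by
  change 0 < -(2 * Real.cos (s.angleIn + s.angleOut)) ↔ _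
  refine ⟨fun h => lt_of_not_ge fun h' => ?_, fun h => ?_⟩
  · linarith [s.cos_angleIn_add_angleOut_pos h']
  · linarith [s.cos_angleIn_add_angleOut_neg h]

theorem seed_B_zero_two_ne_zero : (s.seed F).B 0 2 ≠ 0 := by
  change -(2 * Real.cos (s.angleIn + s.angleOut)) ≠ 0
  obtain h | h := le_or_gt (s.a + s.c) n
  · linarith [s.cos_angleIn_add_angleOut_pos h]
  · linarith [s.cos_angleIn_add_angleOut_neg h]

theorem isAcyclic_mk_seed_iff : Seed.IsAcyclic ⟦s.seed F⟧ ↔ s.IsAcute := by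
  have hB : IsAcyclic (s.seed F).B ↔ 0 < (s.seed F).B 0 2 :=
    isAcyclic_iff_of_path (ρ := 1) (skewMatrix_skew _ _ _) s.seed_B_zero_one_pos
      s.seed_B_one_two_pos s.seed_B_zero_two_ne_zero
  rw [← seed_B_zero_two_pos_iff (F := F), ← hB]
  refine ⟨?_, fun h => ⟨_, rfl, h⟩⟩
  rintro ⟨x, hx, h⟩
  obtain ⟨σ, hσ⟩ := LabelledSeed.mk_eq_iff.1 hx
  rw [hσ]
  exact h.submatrix σ

theorem isSource_seed_iff {k : Fin 3} : IsSource (s.seed F).B k ↔ k = 0 ∧ s.IsAcute := by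
  have h10 : (s.seed F).B 1 0 < 0 := neg_lt_zero.2 (s.seed_B_zero_one_pos (F := F))
  have h21 : (s.seed F).B 2 1 < 0 := neg_lt_zero.2 (s.seed_B_one_two_pos (F := F))
  rw [← s.seed_B_zero_two_pos_iff (F := F)]
  constructor
  · intro h
    fin_cases k
    · exact ⟨rfl, (h 2).lt_of_ne' s.seed_B_zero_two_ne_zero⟩
    · exact absurd (h 0) h10.not_ge
    · exact absurd (h 1) h21.not_ge
  · rintro ⟨rfl, h⟩ i
    fin_cases i
    exacts [le_rfl, s.seed_B_zero_one_pos.le, h.le]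

end SeedParams

/-! ### Quivers on triangles with given angles -/

section Angles

variable {n : ℕ} {m : Fin 3 → ℕ} {Q : Matrix (Fin 3) (Fin 3) ℝ} {ρ σ : Equiv.Perm (Fin 3)}

theorem sum_comp_eq_of_sum_eq {N : ℕ} (hm : m 0 + m 1 + m 2 = N) (ρ : Equiv.Perm (Fin 3)) :
    m (ρ 0) + m (ρ 1) + m (ρ 2) = N := by
  rw [← hm, ← Fin.sum_univ_three fun i => m (ρ i), ← Fin.sum_univ_three m]
  exact Equiv.sum_comp ρ m

theorem exists_seedParams_angles_eq (hm : m 0 + m 1 + m 2 = 2 * n + 1) (h0 : 1 ≤ m (ρ 0))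
    (h0' : m (ρ 0) ≤ n) (h2 : m (ρ 2) ≤ n) : ∃ s : SeedParams n, ∀ i, s.angles i = m (ρ i) := by
  refine ⟨⟨m (ρ 0), m (ρ 2), 1, 0, h0, h0', h2⟩, fun i => ?_⟩
  have h1 : 2 * n + 1 - (m (ρ 0) + m (ρ 2)) = m (ρ 1) := by
    have := sum_comp_eq_of_sum_eq hm ρ
    omega
  fin_cases i
  exacts [rfl, h1, rfl]

theorem SeedParams.gcd_eq_one {s : SeedParams n} (hs : ∀ i, s.angles (σ i) = m i)
    (hg : Nat.gcd (m 0) (Nat.gcd (m 1) (m 2)) = 1) : (s.a.gcd s.c).gcd (2 * n + 1) = 1 := by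
  set d := (s.a.gcd s.c).gcd (2 * n + 1)
  have ha : d ∣ s.a := (Nat.gcd_dvd_left ..).trans (Nat.gcd_dvd_left ..)
  have hc : d ∣ s.c := (Nat.gcd_dvd_left ..).trans (Nat.gcd_dvd_right ..)
  have hangles (i : Fin 3) : d ∣ s.angles i := by
    fin_cases i
    exacts [ha, Nat.dvd_sub (Nat.gcd_dvd_right ..) (dvd_add ha hc), hc]
  have hd (i : Fin 3) : d ∣ m i := hs i ▸ hangles (σ i)
  exact Nat.dvd_one.1 (hg ▸ Nat.dvd_gcd (hd 0) (Nat.dvd_gcd (hd 1) (hd 2)))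

namespace IsQuiverOf

theorem abs_eq {θ : Fin 3 → ℝ} (hQ : IsQuiverOf θ Q) {i j k : Fin 3} (hij : i ≠ j) (hjk : j ≠ k)
    (hik : i ≠ k) : |Q i j| = 2 * |Real.cos (θ k)| := by
  have key : ∀ i j k : Fin 3, i ≠ j → j ≠ k → i ≠ k →
      i = k + 1 ∧ j = k + 2 ∨ j = k + 1 ∧ i = k + 2 := by decide
  obtain ⟨rfl, rfl⟩ | ⟨rfl, rfl⟩ := key i j k hij hjk hik
  · exact hQ.weight k
  · rw [hQ.skew, abs_neg]
    exact hQ.weight k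

theorem abs_apply_comp {θ : Fin 3 → ℝ} (hQ : IsQuiverOf θ Q) (ρ : Equiv.Perm (Fin 3))
    {i j k : Fin 3} (hij : i ≠ j) (hjk : j ≠ k) (hik : i ≠ k) :
    |Q (ρ i) (ρ j)| = 2 * |Real.cos (θ (ρ k))| :=
  hQ.abs_eq (ρ.injective.ne hij) (ρ.injective.ne hjk) (ρ.injective.ne hik)

/-- The middle side of the path is opposite to the obtuse angle, if there is one. -/
theorem exists_path (hm : m 0 + m 1 + m 2 = 2 * n + 1)
    (hQ : IsQuiverOf (fun i => m i * fundAngle n) Q) : ∃ ρ : Equiv.Perm (Fin 3),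
      (0 < Q (ρ 0) (ρ 1) ∧ 0 < Q (ρ 1) (ρ 2) ∧
        Q (ρ 0) (ρ 2) = 2 * Real.cos (m (ρ 1) * fundAngle n)) ∧
      1 ≤ m (ρ 0) ∧ m (ρ 0) ≤ n ∧ m (ρ 2) ≤ n := by
  have hle (i : Fin 3) : m i ≤ 2 * n + 1 := by fin_cases i <;> simp <;> omega
  have hcos (k : Fin 3) : Real.cos (m k * fundAngle n) ≠ 0 := by
    obtain h | h := le_or_gt (m k) n
    exacts [(cos_mul_fundAngle_pos h).ne', (cos_mul_fundAngle_neg h (hle k)).ne]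
  have h0 (i j : Fin 3) (hij : i ≠ j) : Q i j ≠ 0 := by
    obtain ⟨k, hjk, hik⟩ : ∃ k, j ≠ k ∧ i ≠ k := by decide +revert
    rw [← abs_ne_zero, hQ.abs_eq hij hjk hik]
    exact mul_ne_zero two_ne_zero (abs_ne_zero.2 (hcos k))
  have habs (ρ : Equiv.Perm (Fin 3)) := hQ.abs_apply_comp ρ (i := 0) (j := 2) (k := 1)
    (by decide) (by decide) (by decide)
  by_cases hobtuse : ∃ j, n < m j
  · obtain ⟨j, hj⟩ := hobtuse
    obtain ⟨ρ, rfl, h01, h12, h02⟩ := exists_path_through hQ.skew h0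
      (hQ.obtuse ⟨j, pi_div_two_lt_mul_fundAngle hj⟩) j
    have hsum := sum_comp_eq_of_sum_eq hm ρ
    refine ⟨ρ, ⟨h01, h12, ?_⟩, Nat.one_le_iff_ne_zero.2 fun hz => h02.not_gt ?_, by omega, by omega⟩
    · have := habs ρ
      rw [abs_of_neg h02, abs_of_neg (cos_mul_fundAngle_neg hj (hle _)), mul_neg] at this
      exact neg_injective this
    · exact hQ.infinite (ρ 0) (ρ 1) (ρ 2) (ρ.injective.ne (by decide)) (ρ.injective.ne (by decide))
        (ρ.injective.ne (by decide)) (by simp [hz]) (pi_div_two_lt_mul_fundAngle hj)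
  · have hacute (i : Fin 3) : m i ≤ n := not_lt.1 fun h => hobtuse ⟨i, h⟩
    obtain ⟨ρ, h01, h12⟩ := AffineSeed.exists_path hQ.skew h0
    have h02 := (isAcyclic_iff_of_path hQ.skew h01 h12 (h0 _ _ (ρ.injective.ne (by decide)))).1
      (hQ.acute fun i => mul_fundAngle_lt_pi_div_two (hacute i))
    have hsum := sum_comp_eq_of_sum_eq hm ρ
    have := hacute (ρ 1); have := hacute (ρ 2)
    refine ⟨ρ, ⟨h01, h12, ?_⟩, by omega, hacute _, hacute _⟩
    rw [← abs_of_pos h02, habs, abs_of_pos (cos_mul_fundAngle_pos (hacute _))]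

theorem submatrix_eq (hQ : IsQuiverOf (fun i => m i * fundAngle n) Q) (h01 : 0 < Q (ρ 0) (ρ 1))
    (h12 : 0 < Q (ρ 1) (ρ 2)) (h02 : Q (ρ 0) (ρ 2) = 2 * Real.cos (m (ρ 1) * fundAngle n))
    {s : SeedParams n} (hs : ∀ i, s.angles i = m (ρ i)) :
    Q.submatrix ρ ρ = standardQuiver s.angleIn s.angleOut := by
  have e01 := hQ.abs_apply_comp ρ (i := 0) (j := 1) (k := 2) (by decide) (by decide) (by decide)
  have e12 := hQ.abs_apply_comp ρ (i := 1) (j := 2) (k := 0) (by decide) (by decide) (by decide)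
  rw [abs_of_pos h01, ← hs] at e01
  rw [abs_of_pos h12, ← hs] at e12
  rw [← hs, s.angles_one_mul_fundAngle, Real.cos_pi_sub, mul_neg] at h02
  refine (eq_skewMatrix (B := Q.submatrix ρ ρ) fun i j => hQ.skew (ρ i) (ρ j)).trans ?_
  rw [Matrix.submatrix_apply, Matrix.submatrix_apply, Matrix.submatrix_apply, e01, e12, h02]
  exact congrArg₂ (skewMatrix · · _) (congrArg _ (abs_of_pos s.cos_angleOut_pos))
    (congrArg _ (abs_of_pos s.cos_angleIn_pos))

theorem exists_seedParams (hm : m 0 + m 1 + m 2 = 2 * n + 1)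
    (hQ : IsQuiverOf (fun i => m i * fundAngle n) Q) :
    ∃ (s : SeedParams n) (σ : Equiv.Perm (Fin 3)), (∀ i, s.angles (σ i) = m i) ∧
      (standardQuiver s.angleIn s.angleOut).submatrix σ σ = Q := by
  obtain ⟨ρ, ⟨h01, h12, h02⟩, h0, h0', h2⟩ := hQ.exists_path hm
  obtain ⟨s, hs⟩ := exists_seedParams_angles_eq hm h0 h0' h2
  refine ⟨s, ρ.symm, fun i => by rw [hs, ρ.apply_symm_apply], ?_⟩
  rw [← hQ.submatrix_eq h01 h12 h02 hs, Matrix.submatrix_submatrix, ρ.self_comp_symm,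
    Matrix.submatrix_id_id]

end IsQuiverOf

theorem exists_seedParams_of_sum_eq (hn : 1 ≤ n) (hm : m 0 + m 1 + m 2 = 2 * n + 1)
    (hg : Nat.gcd (m 0) (Nat.gcd (m 1) (m 2)) = 1) :
    ∃ (s : SeedParams n) (σ : Equiv.Perm (Fin 3)), ∀ i, s.angles (σ i) = m i := by
  have hρ : ∃ ρ : Equiv.Perm (Fin 3), 1 ≤ m (ρ 0) ∧ m (ρ 0) ≤ n ∧ m (ρ 2) ≤ n := by
    have h01 : m 0 ≠ 0 ∨ m 1 ≠ 0 := by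
      by_contra! h
      rw [h.1, h.2, Nat.gcd_zero_left, Nat.gcd_zero_left] at hg
      omega
    have h02 : m 0 ≠ 0 ∨ m 2 ≠ 0 := by
      by_contra! h
      rw [h.1, h.2, Nat.gcd_zero_right, Nat.gcd_zero_left] at hg
      omega
    have h12 : m 1 ≠ 0 ∨ m 2 ≠ 0 := by
      by_contra! h
      rw [h.1, h.2, Nat.gcd_zero_right, Nat.gcd_zero_right] at hg
      omega
    have key : (1 ≤ m 0 ∧ m 0 ≤ n ∧ m 2 ≤ n) ∨ (1 ≤ m 0 ∧ m 0 ≤ n ∧ m 1 ≤ n) ∨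
        (1 ≤ m 1 ∧ m 1 ≤ n ∧ m 0 ≤ n) ∨ (1 ≤ m 1 ∧ m 1 ≤ n ∧ m 2 ≤ n) ∨
        (1 ≤ m 2 ∧ m 2 ≤ n ∧ m 0 ≤ n) ∨ (1 ≤ m 2 ∧ m 2 ≤ n ∧ m 1 ≤ n) := by omega
    obtain h | h | h | h | h | h := key
    exacts [⟨1, h⟩, ⟨Equiv.swap 1 2, h⟩, ⟨finRotate 3, h⟩, ⟨Equiv.swap 0 1, h⟩,
      ⟨Equiv.swap 0 2, h⟩, ⟨(finRotate 3).symm, h⟩]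
  obtain ⟨ρ, h0, h0', h2⟩ := hρ
  obtain ⟨s, hs⟩ := exists_seedParams_angles_eq hm h0 h0' h2
  exact ⟨s, ρ.symm, fun i => by rw [hs, ρ.apply_symm_apply]⟩

end Angles

/-! ### Altitudes of a triangle -/

section Altitude

open Affine.Simplex

variable (Δ : Affine.Triangle ℝ Plane) {i j k : Fin 3}

theorem norm_altitudeFoot_sub (i : Fin 3) : ‖Δ.altitudeFoot i - Δ.points i‖ = Δ.height i := by
  rw [← dist_eq_norm, dist_comm]
  rfl

theorem inner_altitudeFoot_sub (h : j ≠ i) :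
    inner ℝ (Δ.altitudeFoot i - Δ.points i) (Δ.points j - Δ.altitudeFoot i) = (0 : ℝ) := by
  rw [real_inner_comm, ← neg_sub (Δ.points i), inner_neg_right, neg_eq_zero]
  exact inner_vsub_altitudeFoot_vsub_altitudeFoot_eq_zero Δ h.symm

theorem exists_altitudeFoot_sub_eq (hij : i ≠ j) (hjk : j ≠ k) (hik : i ≠ k) :
    ∃ r : ℝ, Δ.altitudeFoot i - Δ.points k = r • (Δ.points j - Δ.points k) := by
  have key : ∀ i j k : Fin 3, i ≠ j → j ≠ k → i ≠ k → ∀ l, l ≠ i ↔ l = k ∨ l = j := by decide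
  have hcompl : ({i}ᶜ : Set (Fin 3)) = {k, j} := Set.ext (key i j k hij hjk hik)
  have h := Δ.altitudeFoot_mem_affineSpan_image_compl i
  rw [hcompl, Set.image_pair] at h
  obtain ⟨r, hr⟩ := mem_affineSpan_pair_iff_exists_lineMap_eq.1 h
  exact ⟨r, by rw [← hr, AffineMap.lineMap_apply]; simp⟩

theorem inner_altitude_vsub (hj : j ≠ i) (hk : k ≠ i) :
    inner ℝ (Δ.altitudeFoot i - Δ.points i) (Δ.points j - Δ.points k) = (0 : ℝ) := by
  rw [← sub_sub_sub_cancel_right (Δ.points j) (Δ.points k) (Δ.altitudeFoot i), inner_sub_right,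
    inner_altitudeFoot_sub Δ hj, inner_altitudeFoot_sub Δ hk, sub_zero]

theorem exists_altitude_eq (hij : i ≠ j) (hjk : j ≠ k) (hik : i ≠ k) :
    ∃ r : ℝ, Δ.altitudeFoot i - Δ.points i =
        r • (Δ.points j - Δ.points k) - (Δ.points i - Δ.points k) ∧
      r * ‖Δ.points j - Δ.points k‖ ^ 2 =
        inner ℝ (Δ.points i - Δ.points k) (Δ.points j - Δ.points k) := by
  obtain ⟨r, hr⟩ := exists_altitudeFoot_sub_eq Δ hij hjk hik
  have h : Δ.altitudeFoot i - Δ.points i =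
      r • (Δ.points j - Δ.points k) - (Δ.points i - Δ.points k) := by rw [← hr]; abel
  have hperp := inner_altitude_vsub Δ hij.symm hik.symm
  rw [h, inner_sub_left, real_inner_smul_left, real_inner_self_eq_norm_sq, sub_eq_zero] at hperp
  exact ⟨r, h, hperp⟩

theorem height_eq_norm_mul_sin (hij : i ≠ j) (hjk : j ≠ k) (hik : i ≠ k) :
    Δ.height i =
      ‖Δ.points i - Δ.points k‖ * Real.sin (∠ (Δ.points i) (Δ.points k) (Δ.points j)) := by
  obtain ⟨r, h, hr⟩ := exists_altitude_eq Δ hij hjk hik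
  have hcos := InnerProductGeometry.cos_angle_mul_norm_mul_norm (Δ.points i - Δ.points k)
    (Δ.points j - Δ.points k)
  have hq : 0 < ‖Δ.points j - Δ.points k‖ :=
    norm_sub_pos_iff.2 (Δ.independent.injective.ne hjk)
  have hsin : 0 ≤ Real.sin (∠ (Δ.points i) (Δ.points k) (Δ.points j)) :=
    InnerProductGeometry.sin_angle_nonneg _ _
  refine (sq_eq_sq₀ (Δ.height_pos i).le (by positivity)).1 (mul_right_cancel₀ (pow_pos hq 2).ne' ?_)
  rw [mul_pow, Real.sin_sq, ← norm_altitudeFoot_sub, h, norm_sub_sq_real, norm_smul, mul_pow,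
    Real.norm_eq_abs, sq_abs, real_inner_smul_left, real_inner_comm, ← hr]
  change _ = ‖_‖ ^ 2 * (1 - Real.cos (InnerProductGeometry.angle _ _) ^ 2) * ‖_‖ ^ 2
  rw [← hr] at hcos
  linear_combination (r * ‖Δ.points j - Δ.points k‖ ^ 2 + Real.cos (InnerProductGeometry.angle
    (Δ.points i - Δ.points k) (Δ.points j - Δ.points k)) * (‖Δ.points i - Δ.points k‖ *
      ‖Δ.points j - Δ.points k‖)) * hcos

theorem inner_altitude_altitude (hij : i ≠ j) (hjk : j ≠ k) (hik : i ≠ k) :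
    inner ℝ (Δ.altitudeFoot i - Δ.points i) (Δ.altitudeFoot j - Δ.points j) =
      -(Real.cos (∠ (Δ.points i) (Δ.points k) (Δ.points j)) * (Δ.height i * Δ.height j)) := by
  obtain ⟨r, h, hr⟩ := exists_altitude_eq Δ hij hjk hik
  have hi := height_eq_norm_mul_sin Δ hij hjk hik
  have hj := height_eq_norm_mul_sin Δ hij.symm hik hjk
  have hcos : Real.cos (∠ (Δ.points i) (Δ.points k) (Δ.points j)) * _ = _ :=
    InnerProductGeometry.cos_angle_mul_norm_mul_norm (Δ.points i - Δ.points k)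
      (Δ.points j - Δ.points k)
  have hq : 0 < ‖Δ.points j - Δ.points k‖ :=
    norm_sub_pos_iff.2 (Δ.independent.injective.ne hjk)
  have hside : inner ℝ (Δ.points j - Δ.points k) (Δ.altitudeFoot j - Δ.points j) =
      -Δ.height j ^ 2 := by
    rw [← norm_altitudeFoot_sub, ← real_inner_self_eq_norm_sq,
      ← sub_sub_sub_cancel_right _ (Δ.points k) (Δ.altitudeFoot j), inner_sub_left,
      real_inner_comm _ (Δ.points k - _), inner_altitudeFoot_sub Δ hjk.symm, ← inner_neg_left,
      neg_sub, sub_zero, ← neg_sub, inner_neg_left]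
  have hperp : inner ℝ (Δ.points i - Δ.points k) (Δ.altitudeFoot j - Δ.points j) = (0 : ℝ) := by
    rw [real_inner_comm, inner_altitude_vsub Δ hij hjk.symm]
  rw [EuclideanGeometry.angle_comm] at hj
  have hrj : r * Δ.height j =
      Real.cos (∠ (Δ.points i) (Δ.points k) (Δ.points j)) * Δ.height i := by
    refine mul_right_cancel₀ (pow_pos hq 2).ne' ?_
    rw [mul_right_comm, hr, ← hcos, hi, hj]
    ring
  rw [h, inner_sub_left, real_inner_smul_left, hside, hperp]
  linear_combination -Δ.height j * hrj

theorem sideFun_fst (i : Fin 3) :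
    (sideFun Δ i).1 = (√2 / Δ.height i) • (Δ.altitudeFoot i - Δ.points i) := by
  rw [← norm_altitudeFoot_sub, sideFun]

theorem form_sideFun_self (i : Fin 3) : (sideFun Δ i).form (sideFun Δ i) = 2 := by
  have h := (Δ.height_pos i).ne'
  rw [AffFun.form, sideFun_fst, real_inner_smul_left, real_inner_smul_right,
    real_inner_self_eq_norm_sq, norm_altitudeFoot_sub]
  field_simp
  exact Real.sq_sqrt zero_le_two

theorem form_sideFun_of_ne (hij : i ≠ j) (hjk : j ≠ k) (hik : i ≠ k) :
    (sideFun Δ i).form (sideFun Δ j) =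
      -(2 * Real.cos (∠ (Δ.points i) (Δ.points k) (Δ.points j))) := by
  have hi := (Δ.height_pos i).ne'
  have hj := (Δ.height_pos j).ne'
  rw [AffFun.form, sideFun_fst, sideFun_fst, real_inner_smul_left, real_inner_smul_right,
    inner_altitude_altitude Δ hij hjk hik]
  field_simp
  rw [Real.sq_sqrt zero_le_two]
  ring

theorem eval_sideFun_altitudeFoot (i : Fin 3) :
    (sideFun Δ i).eval (Δ.altitudeFoot i) = 0 := by
  simp [sideFun, AffFun.eval]

theorem eval_sideFun_point_of_ne (h : j ≠ i) : (sideFun Δ i).eval (Δ.points j) = 0 := by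
  have := inner_altitudeFoot_sub Δ h
  rw [inner_sub_right] at this
  simp only [sideFun, AffFun.eval, real_inner_smul_left]
  linear_combination (√2 / ‖Δ.altitudeFoot i - Δ.points i‖) * this

theorem eval_sideFun_point_self (i : Fin 3) :
    (sideFun Δ i).eval (Δ.points i) = -(√2 * Δ.height i) := by
  have h := (Δ.height_pos i).ne'
  have hfoot := eval_sideFun_altitudeFoot Δ i
  have hdiff : inner ℝ (sideFun Δ i).1 (Δ.altitudeFoot i - Δ.points i) = √2 * Δ.height i := by
    rw [sideFun_fst, real_inner_smul_left, real_inner_self_eq_norm_sq, norm_altitudeFoot_sub]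
    field_simp
  rw [inner_sub_right] at hdiff
  rw [AffFun.eval] at hfoot ⊢
  linarith

theorem eval_sideFun_altitudeFoot_of_ne (h : j ≠ i) :
    (sideFun Δ i).eval (Δ.altitudeFoot j) =
      Δ.height j / √2 * (sideFun Δ i).form (sideFun Δ j) := by
  have hpoint := eval_sideFun_point_of_ne Δ h
  have hj := (Δ.height_pos j).ne'
  rw [AffFun.form, sideFun_fst Δ j, real_inner_smul_right, inner_sub_right]
  rw [AffFun.eval] at hpoint ⊢
  field_simp
  linarith

end Altitude

section Sides

variable (Δ : Affine.Triangle ℝ Plane) {i j k : Fin 3}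

theorem height_mul_sin_comm (hij : i ≠ j) (hjk : j ≠ k) (hik : i ≠ k) :
    Δ.height i * Real.sin (∠ (Δ.points j) (Δ.points i) (Δ.points k)) =
      Δ.height j * Real.sin (∠ (Δ.points i) (Δ.points j) (Δ.points k)) := by
  rw [height_eq_norm_mul_sin Δ hik hjk.symm hij, height_eq_norm_mul_sin Δ hjk hik.symm hij.symm,
    norm_sub_rev (Δ.points j)]
  ring

theorem eval_sum_smul_sideFun (c : Fin 3 → ℝ) (i : Fin 3) :
    (∑ j, c j • sideFun Δ j).eval (Δ.points i) = -(√2 * (c i * Δ.height i)) := by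
  have hlin : (∑ j, c j • sideFun Δ j).eval (Δ.points i) =
      ∑ j, c j * (sideFun Δ j).eval (Δ.points i) := by
    simp only [AffFun.eval, Prod.fst_sum, Prod.snd_sum, Prod.smul_fst, Prod.smul_snd, sum_inner,
      real_inner_smul_left, smul_eq_mul, mul_add, Finset.sum_add_distrib]
  rw [hlin, Finset.sum_eq_single i, eval_sideFun_point_self]
  · ring
  · intro j _ hj
    rw [eval_sideFun_point_of_ne Δ hj.symm, mul_zero]
  · simp

theorem sum_inv_height_smul_sideFun : ∑ i : Fin 3, (Δ.height i)⁻¹ • sideFun Δ i = (0, -√2) := by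
  have hfst : (∑ i : Fin 3, (Δ.height i)⁻¹ • sideFun Δ i).1 = 0 := by
    have h := congrArg (fun w => -√2 • w) Δ.sum_inv_height_sq_smul_vsub_eq_zero
    rw [smul_zero, Finset.smul_sum] at h
    rw [Prod.fst_sum, ← h]
    refine Finset.sum_congr rfl fun i _ => ?_
    rw [Prod.smul_fst, sideFun_fst, vsub_eq_sub]
    module
  have heval := eval_sum_smul_sideFun Δ (fun i => (Δ.height i)⁻¹) 0
  rw [inv_mul_cancel₀ (Δ.height_pos 0).ne', mul_one, AffFun.eval, hfst, inner_zero_left,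
    zero_add] at heval
  exact Prod.ext hfst heval

end Sides

namespace Frame

variable (F : Frame)

/-- The image of a coordinate system under an isometry of the plane. -/
def map (φ : Plane ≃ᵃⁱ[ℝ] Plane) : Frame :=
  { F with origin := φ F.origin, b := F.b.map φ.linearIsometryEquiv }

theorem map_pt (φ : Plane ≃ᵃⁱ[ℝ] Plane) (r t : ℝ) : (F.map φ).pt r t = φ (F.pt r t) := by
  rw [pt, pt, add_comm F.origin, ← vadd_eq_add (F.vec r t), φ.map_vadd, vadd_eq_add, add_comm]
  simp [map, vec]

theorem coordFun_map (φ : Plane ≃ᵃⁱ[ℝ] Plane) (q : ℝ × ℝ × ℝ) :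
    (F.map φ).coordFun q = (F.coordFun q).move φ := by
  refine AffFun.ext_eval fun p => ?_
  obtain ⟨r, t, rfl⟩ := (F.map φ).exists_pt p
  rw [AffFun.eval_move, eval_coordFun, map_pt, φ.symm_apply_apply, eval_coordFun, map]

end Frame

namespace SeedParams

variable {n : ℕ} {s : SeedParams n} {Δ : Affine.Triangle ℝ Plane} {F : Frame}

theorem exists_frame_sideFun_eq (hΔ : ∀ i j k, i ≠ j → j ≠ k → i ≠ k →
      ∠ (Δ.points i) (Δ.points k) (Δ.points j) = s.angles k * fundAngle n) :
    ∃ F : Frame, sideFun Δ = (s.seed F).v := by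
  have hsin : 0 < Real.sin (s.angles 0 * fundAngle n) := s.sin_angleIn_pos
  let u := Δ.height 0 * Real.sin (s.angles 0 * fundAngle n)
  have hheight : ∀ i, Real.sin (s.angles i * fundAngle n) = u * (Δ.height i)⁻¹ := by
    intro i
    rw [← div_eq_mul_inv, eq_div_iff (Δ.height_pos i).ne', mul_comm]
    rcases eq_or_ne i 0 with rfl | hi
    · rfl
    · obtain ⟨k, hik, h0k⟩ : ∃ k, i ≠ k ∧ 0 ≠ k := by decide +revert
      have h := height_mul_sin_comm Δ hi h0k hik
      rwa [hΔ 0 k i h0k hik.symm hi.symm, hΔ i k 0 hik h0k.symm hi] at h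
  let F : Frame := ⟨0, EuclideanSpace.basisFun (Fin 2) ℝ, u, mul_pos (Δ.height_pos 0) hsin⟩
  have hsum : ∑ i, Real.sin (s.angles i * fundAngle n) • sideFun Δ i =
      (0, -(√2 * F.unit)) := by
    simp only [hheight, mul_smul, ← Finset.smul_sum, sum_inv_height_smul_sideFun]
    simp [F, mul_comm]
  have hform (i j : Fin 3) : (sideFun Δ i).form (sideFun Δ j) =
      ((s.seed F).v i).form ((s.seed F).v j) := by
    rcases eq_or_ne i j with rfl | hij
    · rw [form_sideFun_self, form_seed_self]
    · obtain ⟨k, hik, hjk⟩ : ∃ k, i ≠ k ∧ j ≠ k := by decide +revert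
      rw [form_sideFun_of_ne Δ hij hjk hik, form_seed_of_ne s hij hjk hik, hΔ i j k hij hjk hik]
  obtain ⟨φ, hφ⟩ := areCongruent_of_form_eq s.linearIndependent_seed hform
    (neg_sqrt_two_mul_unit_neg F).ne hsum s.sum_sin_smul_seed
  exact ⟨F.map φ, funext fun i => (hφ i).trans (F.coordFun_map φ _).symm⟩

theorem eq_of_eval_eq {p q : Plane} (h0 : ((s.seed F).v 0).eval p = ((s.seed F).v 0).eval q)
    (h2 : ((s.seed F).v 2).eval p = ((s.seed F).v 2).eval q) : p = q := by
  obtain ⟨r, t, rfl⟩ := F.exists_pt p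
  obtain ⟨r', t', rfl⟩ := F.exists_pt q
  have hu : √2 * F.unit ≠ 0 := neg_ne_zero.1 (neg_sqrt_two_mul_unit_neg F).ne
  have hS := s.sin_angleIn_add_angleOut_pos.ne'
  have hε := intUnit_sq s.ε
  replace h0 := mul_left_cancel₀ hu
    ((F.eval_coordFun _ _ _ _ _).symm.trans (h0.trans (F.eval_coordFun _ _ _ _ _)))
  replace h2 := mul_left_cancel₀ hu
    ((F.eval_coordFun _ _ _ _ _).symm.trans (h2.trans (F.eval_coordFun _ _ _ _ _)))
  rw [Real.sin_add] at hS
  have hr : r = r' := mul_left_cancel₀ hS (by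
    linear_combination Real.cos s.angleIn * h2 - Real.cos s.angleOut * h0)
  have ht : t = t' := mul_left_cancel₀ hS (by
    linear_combination s.ε * Real.sin s.angleOut * h0 + s.ε * Real.sin s.angleIn * h2 -
      (Real.sin s.angleIn * Real.cos s.angleOut + Real.cos s.angleIn * Real.sin s.angleOut) *
        (t - t') * hε)
  rw [hr, ht]

section BeltLine

variable (hv : sideFun Δ = (s.seed F).v)

include hv

theorem height_mul_sin_angles (i : Fin 3) :
    Δ.height i * Real.sin (s.angles i * fundAngle n) = F.unit := by
  have h := eval_sum_smul_sideFun Δ (fun j => Real.sin (s.angles j * fundAngle n)) i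
  rw [hv, sum_sin_smul_seed, AffFun.eval, inner_zero_left, zero_add, neg_inj,
    mul_comm _ (Δ.height i)] at h
  exact (mul_left_cancel₀ (by positivity) h).symm

theorem altitudeFoot_zero_eq : Δ.altitudeFoot 0 = F.pt s.x 0 := by
  have hsin := s.sin_angleIn_pos.ne'
  have hheight : Δ.height 0 * Real.sin s.angleIn = F.unit := height_mul_sin_angles hv 0
  have h0 := eval_sideFun_altitudeFoot Δ 0
  have h2 := eval_sideFun_altitudeFoot_of_ne Δ (show (0 : Fin 3) ≠ 2 by decide)
  rw [hv] at h0 h2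
  rw [AffFun.form_comm, seed, Frame.form_standardSeed_zero_two] at h2
  refine s.eq_of_eval_eq (F := F) (h0.trans ?_) (h2.trans ?_)
  · refine Eq.trans ?_ (F.eval_coordFun _ _ _ _ _).symm
    ring
  · refine Eq.trans ?_ (F.eval_coordFun _ _ _ _ _).symm
    rw [← hheight]
    field_simp
    rw [Real.sq_sqrt zero_le_two]
    ring

theorem altitudeFoot_two_eq (hsin : Real.sin s.angleOut ≠ 0) :
    Δ.altitudeFoot 2 = F.pt (s.x - Real.cos (s.angleIn + s.angleOut) /
      (Real.sin s.angleIn * Real.sin s.angleOut)) 0 := by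
  have hsin' := s.sin_angleIn_pos.ne'
  have hheight : Δ.height 2 * Real.sin s.angleOut = F.unit := height_mul_sin_angles hv 2
  have h2 := eval_sideFun_altitudeFoot Δ 2
  have h0 := eval_sideFun_altitudeFoot_of_ne Δ (show (2 : Fin 3) ≠ 0 by decide)
  rw [hv] at h0 h2
  rw [seed, Frame.form_standardSeed_zero_two] at h0
  refine s.eq_of_eval_eq (F := F) (h0.trans ?_) (h2.trans ?_)
  · refine Eq.trans ?_ (F.eval_coordFun _ _ _ _ _).symm
    rw [← hheight]
    field_simp
    rw [Real.sq_sqrt zero_le_two]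
    ring
  · refine Eq.trans ?_ (F.eval_coordFun _ _ _ _ _).symm
    field_simp
    ring

theorem exists_altitudeFoot_eq (hs : s.IsAcute) :
    ∃ d > 0, Δ.altitudeFoot 0 = F.pt s.x 0 ∧ Δ.altitudeFoot 2 = F.pt (s.x + d) 0 := by
  have hsin : 0 < Real.sin s.angleOut :=
    sin_mul_fundAngle_pos (by have := s.a_le; unfold IsAcute at hs; omega)
      (by have := s.c_le; omega)
  refine ⟨_, div_pos (neg_pos.2 (s.cos_angleIn_add_angleOut_neg hs))
    (mul_pos s.sin_angleIn_pos hsin), altitudeFoot_zero_eq hv, ?_⟩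
  rw [altitudeFoot_two_eq hv hsin.ne']
  ring_nf

end BeltLine

end SeedParams

section BeltDirection

variable {Δ : Affine.Triangle ℝ Plane} {F : Frame} {x d : ℝ}

theorem beltVector_eq (h0 : Δ.altitudeFoot 0 = F.pt x 0) (h2 : Δ.altitudeFoot 2 = F.pt (x + d) 0) :
    beltVector Δ = (d * F.unit) • F.b 0 := by
  rw [beltVector, h0, h2, Frame.pt, Frame.pt, Frame.vec, Frame.vec]
  module

theorem positive_eq (hd : 0 < d) (h0 : Δ.altitudeFoot 0 = F.pt x 0)
    (h2 : Δ.altitudeFoot 2 = F.pt (x + d) 0) : positive Δ = F.pos := by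
  have hpt (t : ℝ) : Δ.altitudeFoot 0 + t • beltVector Δ = F.pt (x + t * d) 0 := by
    rw [beltVector_eq h0 h2, h0, Frame.pt, Frame.pt, Frame.vec, Frame.vec]
    module
  have hmap := ((OrderIso.mulRight₀ d hd).trans (OrderIso.addLeft x)).map_atTop
  ext f
  rw [Frame.pos, Set.mem_ofPred_eq, ← hmap, Filter.eventually_map]
  simp only [positive, hpt]
  rfl

theorem beltLine_eq (hd : 0 < d) (h0 : Δ.altitudeFoot 0 = F.pt x 0)
    (h2 : Δ.altitudeFoot 2 = F.pt (x + d) 0) : beltLine Δ = F.axis := by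
  refine AffineSubspace.ext_of_direction_eq ?_
    ⟨Δ.altitudeFoot 0, left_mem_affineSpan_pair ℝ _ _, h0 ▸ F.pt_zero_mem_axis x⟩
  have hne : d * F.unit ≠ 0 := (mul_pos hd F.unit_pos).ne'
  rw [beltLine, direction_affineSpan, vectorSpan_pair_rev, vsub_eq_sub, ← beltVector,
    beltVector_eq h0 h2, Submodule.span_singleton_smul_eq hne.isUnit, Frame.axis,
    AffineSubspace.direction_mk']

theorem inv_norm_smul_beltVector (hd : 0 < d) (h0 : Δ.altitudeFoot 0 = F.pt x 0)
    (h2 : Δ.altitudeFoot 2 = F.pt (x + d) 0) : ‖beltVector Δ‖⁻¹ • beltVector Δ = F.b 0 := by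
  have hpos : 0 < d * F.unit := mul_pos hd F.unit_pos
  rw [beltVector_eq h0 h2, norm_smul, F.b.norm_eq_one, mul_one, Real.norm_of_nonneg hpos.le,
    smul_smul, inv_mul_cancel₀ hpos.ne', one_smul]

end BeltDirection

section Initial

variable {n : ℕ} {Δ : Affine.Triangle ℝ Plane}

/-- The parameters of the initial seed. -/
def initialParams (hn : 1 ≤ n) : SeedParams n := ⟨1, n, 1, 0, le_rfl, hn, le_rfl⟩

theorem isAcute_initialParams (hn : 1 ≤ n) : (initialParams hn).IsAcute :=
  Nat.lt_add_of_pos_left one_pos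

theorem initialParams_angles (hn : 1 ≤ n) : (initialParams hn).angles = ![1, n, n] := by
  have h : 2 * n + 1 - (1 + n) = n := by omega
  simp [SeedParams.angles, initialParams, h]

theorem angle_points_eq (hn : 1 ≤ n) (hΔ : IsInitialTriangle n Δ) {i j k : Fin 3} (hij : i ≠ j)
    (hjk : j ≠ k) (hik : i ≠ k) :
    ∠ (Δ.points i) (Δ.points k) (Δ.points j) = (initialParams hn).angles k * fundAngle n := by
  obtain ⟨h0, h1, h2⟩ := hΔ
  have h0' := (EuclideanGeometry.angle_comm _ _ _).trans h0
  have h1' := (EuclideanGeometry.angle_comm _ _ _).trans h1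
  have h2' := (EuclideanGeometry.angle_comm _ _ _).trans h2
  rw [initialParams_angles]
  fin_cases i <;> fin_cases j <;> fin_cases k <;> simp_all

theorem initialLabelledSeed_B (hn : 1 ≤ n) : (initialLabelledSeed n Δ).B =
    standardQuiver (initialParams hn).angleIn (initialParams hn).angleOut := by
  have hcos : Real.cos ((initialParams hn).angleIn + (initialParams hn).angleOut) =
      -Real.cos (n * fundAngle n) := by
    have hsum := (initialParams hn).angles_one_mul_fundAngle
    simp only [initialParams_angles, Matrix.cons_val_one, Matrix.cons_val_zero] at hsum
    rw [hsum, Real.cos_pi_sub, neg_neg]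
  rw [standardQuiver, hcos]
  simp [initialLabelledSeed, skewMatrix, initialParams, SeedParams.angleIn, SeedParams.angleOut]

/-- `F` has its first axis along the belt line of `Δ`, in the direction from the source to the
sink, and the initial seed is standard in its coordinates. -/
structure IsBeltFrame (hn : 1 ≤ n) (Δ : Affine.Triangle ℝ Plane) (F : Frame) : Prop where
  initialLabelledSeed_eq : initialLabelledSeed n Δ = (initialParams hn).seed F
  positive_eq : positive Δ = F.pos
  beltLine_eq : beltLine Δ = F.axis
  inv_norm_smul_beltVector : ‖beltVector Δ‖⁻¹ • beltVector Δ = F.b 0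

theorem exists_isBeltFrame (hn : 1 ≤ n) (hΔ : IsInitialTriangle n Δ) :
    ∃ F, IsBeltFrame hn Δ F := by
  obtain ⟨F, hF⟩ := SeedParams.exists_frame_sideFun_eq fun _ _ _ => angle_points_eq hn hΔ
  obtain ⟨d, hd, h0, h2⟩ := SeedParams.exists_altitudeFoot_eq hF (isAcute_initialParams hn)
  exact ⟨F, LabelledSeed.ext hF (initialLabelledSeed_B hn), positive_eq hd h0 h2,
    beltLine_eq hd h0 h2, inv_norm_smul_beltVector hd h0 h2⟩

end Initial

/-! ### The belt of source mutations -/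

section SourceChain

variable {n : ℕ} {o s t : SeedParams n} {u : ℤ → SeedParams n}

theorem SeedParams.mutIn_x_lt (s : SeedParams n) : s.mutIn.x < s.x := by
  have h : s.mutIn.x = s.x - shift s.angleIn s.angleOut := by
    unfold SeedParams.mutIn
    split_ifs <;> rfl
  rw [h]
  exact sub_lt_self _ s.shift_angles_pos

theorem SeedParams.not_isAcute_mutMid (s : SeedParams n) : ¬ s.mutMid.IsAcute := by
  have := s.a_le
  have := s.c_le
  unfold SeedParams.mutMid SeedParams.IsAcute
  split_ifs <;> dsimp only <;> omega

/-- The parameters of a sequence of acyclic seeds, each obtained from the preceding one by mutation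
at its source. -/
def IsSourceChain (u : ℤ → SeedParams n) : Prop := ∀ m, (u m).IsAcute ∧ u (m + 1) = (u m).mutIn

theorem exists_isSourceChain (hs : s.IsAcute) : ∃ u, IsSourceChain u ∧ u 0 = s := by
  let e : Equiv.Perm {t : SeedParams n // t.IsAcute} :=
    { toFun := fun t => ⟨t.1.mutIn, t.2.mutIn⟩
      invFun := fun t => ⟨t.1.mutOut, t.2.mutOut⟩
      left_inv := fun t => Subtype.ext (SeedParams.mutOut_mutIn t.2)
      right_inv := fun t => Subtype.ext (SeedParams.mutIn_mutOut t.2) }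
  refine ⟨fun m => (e ^ m) ⟨s, hs⟩, fun m => ⟨((e ^ m) _).2, ?_⟩, rfl⟩
  simp only [add_comm m, zpow_one_add]
  rfl

namespace IsSourceChain

theorem sub_one (h : IsSourceChain u) (m : ℤ) : u (m - 1) = (u m).mutOut := by
  have hm := h (m - 1)
  rw [sub_add_cancel] at hm
  rw [hm.2, SeedParams.mutOut_mutIn hm.1]

theorem injective (h : IsSourceChain u) : Function.Injective u := by
  have hanti : StrictAnti fun m => (u m).x :=
    strictAnti_int_of_succ_lt fun m => by
      rw [(h m).2]
      exact (u m).mutIn_x_lt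
  exact fun m m' hm => hanti.injective (congrArg SeedParams.x hm)

theorem glide (h : IsSourceChain u) (δ : ℤˣ) (r : ℝ) :
    IsSourceChain fun m => (u m).glide δ r := fun m =>
  ⟨(h m).1, by simp only [(h m).2, SeedParams.mutIn_glide]⟩

theorem mutationEquiv (h : IsSourceChain u) (h0 : o.MutationEquiv (u 0)) (m : ℤ) :
    o.MutationEquiv (u m) := by
  induction m using Int.induction_on with
  | zero => exact h0
  | succ k ih =>
    rw [(h k).2]
    exact ih.mutate 0
  | pred k ih =>
    rw [h.sub_one]
    exact ih.mutate 2

theorem exists_mutate_eq_iff (h : IsSourceChain u) (ht : t.IsAcute) (m : ℤ) :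
    (∃ k, t = (u m).mutate k) ↔ t = u (m + 1) ∨ t = u (m - 1) := by
  have hmid : t ≠ (u m).mutMid := fun e => (u m).not_isAcute_mutMid (e ▸ ht)
  rw [(h m).2, h.sub_one, Fin.exists_fin_succ, Fin.exists_fin_two]
  exact or_congr_right (or_iff_right hmid)

end IsSourceChain

end SourceChain

/-! ### The exchange graph -/

section ExchangeGraph

variable {n : ℕ} {F : Frame}

namespace SeedParams

theorem mk_perm_seed_mutate (s : SeedParams n) (σ : Equiv.Perm (Fin 3)) (k : Fin 3) :
    (⟦((s.seed F).perm σ).mutate F.pos k⟧ : Seed) = ⟦(s.mutate (σ k)).seed F⟧ := by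
  rw [LabelledSeed.perm_mutate, LabelledSeed.mk_perm, mk_seed_mutate]

theorem exists_mutate_iff (s : SeedParams n) (q : Seed) :
    (∃ (x : LabelledSeed) (k : Fin 3), (⟦x⟧ : Seed) = ⟦s.seed F⟧ ∧
      (⟦x.mutate F.pos k⟧ : Seed) = q) ↔ ∃ k, q = ⟦(s.mutate k).seed F⟧ := by
  constructor
  · rintro ⟨x, k, hx, rfl⟩
    obtain ⟨σ, rfl⟩ := LabelledSeed.mk_eq_iff.1 hx.symm
    exact ⟨σ k, s.mk_perm_seed_mutate σ k⟩
  · rintro ⟨k, rfl⟩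
    exact ⟨_, k, rfl, s.mk_seed_mutate k⟩

theorem exists_source_mutate_iff (s : SeedParams n) (q : Seed) :
    (∃ (x : LabelledSeed) (k : Fin 3), (⟦x⟧ : Seed) = ⟦s.seed F⟧ ∧ IsSource x.B k ∧
      (⟦x.mutate F.pos k⟧ : Seed) = q) ↔ s.IsAcute ∧ q = ⟦s.mutIn.seed F⟧ := by
  constructor
  · rintro ⟨x, k, hx, hk, rfl⟩
    obtain ⟨σ, rfl⟩ := LabelledSeed.mk_eq_iff.1 hx.symm
    have hσk : IsSource (s.seed F).B (σ k) := σ.forall_congr_right.1 hk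
    obtain ⟨hk0, hs⟩ := s.isSource_seed_iff.1 hσk
    exact ⟨hs, by rw [mk_perm_seed_mutate, hk0]; rfl⟩
  · rintro ⟨hs, rfl⟩
    exact ⟨_, 0, rfl, s.isSource_seed_iff.2 ⟨rfl, hs⟩, s.mk_seed_mutate 0⟩

end SeedParams

variable {hn : 1 ≤ n} {Δ : Affine.Triangle ℝ Plane} {s t : SeedParams n}

namespace IsBeltFrame

variable (hF : IsBeltFrame hn Δ F)

include hF

theorem mem_mutationClass_iff {q : Seed} :
    q ∈ mutationClass n Δ ↔ ∃ t, (initialParams hn).MutationEquiv t ∧ q = ⟦t.seed F⟧ := by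
  rw [mutationClass, hF.initialLabelledSeed_eq, hF.positive_eq]
  constructor
  · rintro ⟨x, rfl, hx⟩
    induction hx with
    | refl => exact ⟨_, .refl _, rfl⟩
    | tail _ hstep ih =>
      obtain ⟨k, rfl⟩ := hstep
      obtain ⟨t, ht, hxt⟩ := ih
      obtain ⟨σ, rfl⟩ := LabelledSeed.mk_eq_iff.1 hxt.symm
      exact ⟨_, ht.mutate (σ k), t.mk_perm_seed_mutate σ k⟩
  · rintro ⟨t, ht, rfl⟩
    induction ht with
    | refl => exact ⟨_, rfl, .refl⟩
    | @tail t _ _ hstep ih =>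
      obtain ⟨k, rfl⟩ := hstep
      obtain ⟨x, hxt, hx⟩ := ih
      obtain ⟨σ, rfl⟩ := LabelledSeed.mk_eq_iff.1 hxt.symm
      refine ⟨_, ?_, hx.tail ⟨σ.symm k, rfl⟩⟩
      rw [t.mk_perm_seed_mutate, σ.apply_symm_apply]

theorem lengthLattice_eq :
    lengthLattice n Δ = (initialParams hn).period.map (AddMonoidHom.mulRight F.unit) := by
  apply le_antisymm
  · rw [lengthLattice, AddSubgroup.closure_le]
    rintro _ ⟨w, ⟨_, hp⟩, ⟨_, hq⟩, h, rfl⟩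
    obtain ⟨s, hs, rfl⟩ := hF.mem_mutationClass_iff.1 hp
    obtain ⟨t, ht, rfl⟩ := hF.mem_mutationClass_iff.1 hq
    obtain ⟨r, rfl, rfl⟩ := SeedParams.eq_glide_of_translate h
    exact ⟨|r|, abs_mem_iff.2 ((SeedParams.mem_period ht).2 hs), (F.norm_vec_zero_right r).symm⟩
  · rintro _ ⟨r, hr, rfl⟩
    have hlength : |r| * F.unit ∈ lengthLattice n Δ :=
      AddSubgroup.subset_closure ⟨F.vec r 0, ⟨_, hF.mem_mutationClass_iff.2 ⟨_, hr, rfl⟩⟩,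
        ⟨_, hF.mem_mutationClass_iff.2 ⟨_, .refl _, rfl⟩⟩, SeedParams.mk_seed_glide_one _ r,
        (F.norm_vec_zero_right r).symm⟩
    rwa [← abs_mem_iff, AddMonoidHom.coe_mulRight, abs_mul, abs_of_pos F.unit_pos]

theorem mem_translationLattice_iff {w : Plane} :
    w ∈ translationLattice n Δ ↔ ∃ r ∈ (initialParams hn).period, F.vec r 0 = w := by
  rw [translationLattice, hF.lengthLattice_eq, hF.inv_norm_smul_beltVector, AddSubgroup.map_map,
    AddSubgroup.mem_map]
  simp only [F.vec_zero_right]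
  rfl

theorem exchangeGraph_adj_iff {p q : mutationClass n Δ} (hp : (p : Seed) = ⟦s.seed F⟧)
    (hq : (q : Seed) = ⟦t.seed F⟧) :
    (exchangeGraph n Δ).Adj p q ↔ s ≠ t ∧ ∃ k, t = s.mutate k := by
  have hmk {s t : SeedParams n} : (⟦s.seed F⟧ : Seed) = ⟦t.seed F⟧ ↔ s = t :=
    (SeedParams.mk_seed_injective F).eq_iff
  have hsymm : (∃ k, s = t.mutate k) → ∃ k, t = s.mutate k := by
    rintro ⟨k, rfl⟩
    obtain ⟨l, hl⟩ := t.exists_mutate_mutate k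
    exact ⟨l, hl.symm⟩
  rw [exchangeGraph, SimpleGraph.fromRel_adj, ← Subtype.coe_ne_coe, hp, hq, hF.positive_eq,
    s.exists_mutate_iff, t.exists_mutate_iff]
  simp only [hmk, ne_eq]
  exact and_congr_right fun _ => or_iff_left_of_imp hsymm

theorem isInitialBelt_iff {I : ℤ → mutationClass n Δ} : IsInitialBelt n Δ I ↔
    ∃ u, IsSourceChain u ∧ u 0 = initialParams hn ∧ ∀ m, (I m : Seed) = ⟦(u m).seed F⟧ := by
  rw [IsInitialBelt, initialSeed, hF.initialLabelledSeed_eq, hF.positive_eq]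
  constructor
  · rintro ⟨h0, hstep⟩
    choose u _ hI using fun m => hF.mem_mutationClass_iff.1 (I m).2
    simp only [hI, SeedParams.exists_source_mutate_iff] at h0 hstep
    exact ⟨u, fun m => ⟨(hstep m).1, SeedParams.mk_seed_injective F (hstep m).2⟩,
      SeedParams.mk_seed_injective F h0, hI⟩
  · rintro ⟨u, hu, h0, hI⟩
    simp only [hI, SeedParams.exists_source_mutate_iff, h0, true_and]
    exact fun m => ⟨(hu m).1, by rw [(hu m).2]⟩

theorem exists_isInitialBelt : ∃ I, IsInitialBelt n Δ I := by
  obtain ⟨u, hu, h0⟩ := exists_isSourceChain (isAcute_initialParams hn)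
  have hequiv := hu.mutationEquiv (o := initialParams hn) (by rw [h0]; exact .refl _)
  exact ⟨fun m => ⟨_, hF.mem_mutationClass_iff.2 ⟨u m, hequiv m, rfl⟩⟩,
    hF.isInitialBelt_iff.2 ⟨u, hu, h0, fun _ => rfl⟩⟩

end IsBeltFrame

theorem subset_of_preconnected_induce {V : Type*} {G : SimpleGraph V} {J S : Set V}
    (hJ : (G.induce J).Preconnected) {v : V} (hvJ : v ∈ J) (hvS : v ∈ S)
    (hclosed : ∀ p ∈ S, ∀ q ∈ J, G.Adj p q → q ∈ S) : J ⊆ S := by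
  intro q hq
  obtain ⟨w⟩ := hJ ⟨v, hvJ⟩ ⟨q, hq⟩
  suffices ∀ (x y : J), (G.induce J).Walk x y → (x : V) ∈ S → (y : V) ∈ S from this _ _ w hvS
  intro x y w hx
  induction w with
  | nil => exact hx
  | cons hadj _ ih => exact ih (hclosed _ hx _ (Subtype.prop _) hadj)

theorem isAcyclicBelt_of_adj_mem {J : Set (mutationClass n Δ)}
    (hacyclic : ∀ q ∈ J, (q : Seed).IsAcyclic) (hconn : ((exchangeGraph n Δ).induce J).Connected)
    (hadj : ∀ p ∈ J, ∀ q : mutationClass n Δ, (q : Seed).IsAcyclic →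
      (exchangeGraph n Δ).Adj p q → q ∈ J) : IsAcyclicBelt n Δ J := by
  obtain ⟨v, hv⟩ := hconn.nonempty
  exact ⟨⟨hacyclic, hconn⟩, fun K hK hJK => subset_of_preconnected_induce hK.2.preconnected
    (hJK hv) hv fun p hp q hq => hadj p hp q (hK.1 q hq)⟩

theorem IsBeltFrame.exists_embedding_of_isSourceChain (hF : IsBeltFrame hn Δ F)
    {u : ℤ → SeedParams n} (hu : IsSourceChain u) (h0 : (initialParams hn).MutationEquiv (u 0)) :
    ∃ f : SimpleGraph.hasse ℤ ↪g exchangeGraph n Δ,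
      (∀ m, (f m : Seed) = ⟦(u m).seed F⟧) ∧ IsAcyclicBelt n Δ (Set.range f) := by
  let g (m : ℤ) : mutationClass n Δ :=
    ⟨_, hF.mem_mutationClass_iff.2 ⟨u m, hu.mutationEquiv h0 m, rfl⟩⟩
  have hadj (m m' : ℤ) : (exchangeGraph n Δ).Adj (g m) (g m') ↔
      (SimpleGraph.hasse ℤ).Adj m m' := by
    rw [hF.exchangeGraph_adj_iff (p := g m) (q := g m') rfl rfl,
      hu.exists_mutate_eq_iff (hu m').1, hu.injective.ne_iff, hu.injective.eq_iff,
      hu.injective.eq_iff, SimpleGraph.hasse_adj, Order.covBy_iff_add_one_eq,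
      Order.covBy_iff_add_one_eq]
    omega
  have hinj : Function.Injective g := fun m m' h =>
    hu.injective (SeedParams.mk_seed_injective F (congrArg Subtype.val h))
  let f : SimpleGraph.hasse ℤ ↪g exchangeGraph n Δ := ⟨⟨g, hinj⟩, hadj _ _⟩
  refine ⟨f, fun m => rfl, isAcyclicBelt_of_adj_mem ?_ ?_ ?_⟩
  · rintro _ ⟨m, rfl⟩
    exact (u m).isAcyclic_mk_seed_iff.2 (hu m).1
  · exact f.isoInduceRange.connected_iff.1 ⟨SimpleGraph.hasse_preconnected_of_succ ℤ⟩
  · rintro _ ⟨m, rfl⟩ q hq hmq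
    obtain ⟨t, -, ht⟩ := hF.mem_mutationClass_iff.1 q.2
    rw [ht, t.isAcyclic_mk_seed_iff] at hq
    have hmut := ((hF.exchangeGraph_adj_iff (p := f m) rfl ht).1 hmq).2
    rcases (hu.exists_mutate_eq_iff hq m).1 hmut with rfl | rfl
    · exact ⟨m + 1, Subtype.ext ht.symm⟩
    · exact ⟨m - 1, Subtype.ext ht.symm⟩

theorem IsBeltFrame.exists_embedding_translate (hF : IsBeltFrame hn Δ F)
    {I : ℤ → mutationClass n Δ} (hI : IsInitialBelt n Δ I) {w : Plane}
    (hw : w ∈ translationLattice n Δ) :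
    ∃ f : SimpleGraph.hasse ℤ ↪g exchangeGraph n Δ,
      (∀ m, (f m : Seed) = (I m : Seed).translate w) ∧ IsAcyclicBelt n Δ (Set.range f) := by
  obtain ⟨u, hu, h0, hIu⟩ := hF.isInitialBelt_iff.1 hI
  obtain ⟨r, hr, rfl⟩ := hF.mem_translationLattice_iff.1 hw
  simp only [hIu, ← SeedParams.mk_seed_glide_one]
  exact hF.exists_embedding_of_isSourceChain (hu.glide 1 r) (h0 ▸ hr)

end ExchangeGraph

/-! ### Seeds of a given shape -/

section Shape

variable {n : ℕ} {F : Frame} {hn : 1 ≤ n} {Δ : Affine.Triangle ℝ Plane} {m : Fin 3 → ℕ}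
  {a c : ℕ} {y : ℝ} {d s : SeedParams n} {ρ σ : Equiv.Perm (Fin 3)}

theorem exists_mutationEquiv_glide (hn : 1 ≤ n) :
    ∃ y, (initialParams hn).MutationEquiv ((initialParams hn).glide (-1) y) := by
  obtain ⟨y, hy⟩ := (isAcute_initialParams hn).mutIn_mutIn_mutIn
  exact ⟨y, hy ▸ (((SeedParams.MutationEquiv.refl _).mutate 0).mutate 0).mutate 0⟩

theorem SeedParams.angles_eq_of_perm {s t : SeedParams n} {σ τ : Equiv.Perm (Fin 3)}
    (hform : ∀ i j, ((t.seed F).v (τ i)).form ((t.seed F).v (τ j)) =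
      ((s.seed F).v (σ i)).form ((s.seed F).v (σ j)))
    (hB : (t.seed F).B.submatrix τ τ = (s.seed F).B.submatrix σ σ) : t.a = s.a ∧ t.c = s.c := by
  have hB' : (t.seed F).B = (s.seed F).B.submatrix (σ * τ⁻¹) (σ * τ⁻¹) := by
    ext i j
    simpa using congrFun₂ hB (τ⁻¹ i) (τ⁻¹ j)
  have hone : σ * τ⁻¹ = 1 :=
    perm_eq_one (fun i j => by simpa using hform (τ⁻¹ i) (τ⁻¹ j)) hB'
  rw [hone] at hB'
  exact angles_eq_of_B_eq hB'

/-- The seeds of the exchange graph that are standard in the coordinates given by `F`, with angles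
`a` and `c` (in fundamental angles) opposite to the sides where the belt line enters and leaves. -/
def seedsOfAngles (hn : 1 ≤ n) (Δ : Affine.Triangle ℝ Plane) (F : Frame) (a c : ℕ) :
    Set (mutationClass n Δ) :=
  {q | ∃ t : SeedParams n, (initialParams hn).MutationEquiv t ∧ (q : Seed) = ⟦t.seed F⟧ ∧
    t.a = a ∧ t.c = c}

namespace IsBeltFrame

variable (hF : IsBeltFrame hn Δ F)

include hF

theorem areCongruent_of_hasAngles (hd : ∀ i, d.angles (ρ i) = m i) {x : LabelledSeed}
    (hx : (⟦x⟧ : Seed) ∈ mutationClass n Δ) (hang : HasAngles x.v fun i => m i * fundAngle n) :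
    AreCongruent x.v ((d.seed F).perm ρ).v := by
  obtain ⟨t, -, hxt⟩ := hF.mem_mutationClass_iff.1 hx
  obtain ⟨τ, rfl⟩ := LabelledSeed.mk_eq_iff.1 hxt.symm
  exact SeedParams.areCongruent_seed_perm (t.hasAngles_seed_perm_iff.1 hang) hd

theorem seedsOfShape_eq (hd : ∀ i, d.angles (ρ i) = m i) (hs : ∀ i, s.angles (σ i) = m i) :
    seedsOfShape n Δ ((d.seed F).perm ρ).v
      ((standardQuiver s.angleIn s.angleOut).submatrix σ σ) = seedsOfAngles hn Δ F s.a s.c := by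
  ext q
  constructor
  · rintro ⟨x, hx, hcong, hB⟩
    obtain ⟨t, ht, hqt⟩ := hF.mem_mutationClass_iff.1 q.2
    obtain ⟨τ, rfl⟩ := LabelledSeed.mk_eq_iff.1 (hx.trans hqt).symm
    have hcong' : AreCongruent ((s.seed F).perm σ).v ((d.seed F).perm ρ).v :=
      SeedParams.areCongruent_seed_perm hs hd
    exact ⟨t, ht, hqt, SeedParams.angles_eq_of_perm (τ := τ) (σ := σ)
      (fun i j => (hcong.form_eq i j).trans (hcong'.form_eq i j).symm) hB⟩
  · rintro ⟨t, -, hq, ha, hc⟩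
    have ht : ∀ i, t.angles (σ i) = m i := by
      rw [SeedParams.angles, ha, hc]
      exact hs
    refine ⟨(t.seed F).perm σ, by rw [LabelledSeed.mk_perm, hq],
      SeedParams.areCongruent_seed_perm ht hd, ?_⟩
    rw [SeedParams.angleIn, SeedParams.angleOut, ← ha, ← hc]
    rfl

theorem exists_translate_or_glideReflection
    (hy : (initialParams hn).MutationEquiv ((initialParams hn).glide (-1) y))
    {p q : mutationClass n Δ} (hp : p ∈ seedsOfAngles hn Δ F a c)
    (hq : q ∈ seedsOfAngles hn Δ F a c) :
    (∃ w ∈ translationLattice n Δ, (q : Seed) = (p : Seed).translate w) ∨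
      ∃ w ∈ translationLattice n Δ,
        (q : Seed) = ((p : Seed).move (beltReflection Δ)).translate (F.vec y 0 + w) := by
  obtain ⟨s, hs, hps, hsa, hsc⟩ := hp
  obtain ⟨t, ht, hqt, hta, htc⟩ := hq
  obtain ⟨r, hr, h⟩ := SeedParams.exists_glide_of_same_angles hy hs ht (hta.trans hsa.symm)
    (htc.trans hsc.symm)
  have hw := hF.mem_translationLattice_iff.2 ⟨r, hr, rfl⟩
  refine h.imp (fun h => ⟨_, hw, ?_⟩) fun h => ⟨_, hw, ?_⟩
  · rw [hqt, hps, h, SeedParams.mk_seed_glide_one]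
  · have hvec : F.vec y 0 + F.vec r 0 = F.vec (y + r) 0 := by
      simp only [F.vec_zero_right, add_mul, add_smul]
    rw [hqt, hps, h, hvec, beltReflection, ← SeedParams.mk_seed_glide_neg_one s hF.beltLine_eq,
      ← SeedParams.mk_seed_glide_one, SeedParams.glide_glide, mul_one, zero_add]

theorem exists_two_translation_classes
    (hy : (initialParams hn).MutationEquiv ((initialParams hn).glide (-1) y))
    (h : (initialParams hn).Reaches a c) :
    ∃ s ∈ seedsOfAngles hn Δ F a c, ∃ t ∈ seedsOfAngles hn Δ F a c,
      (¬ ∃ w ∈ translationLattice n Δ, (t : Seed) = (s : Seed).translate w) ∧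
      ∀ r ∈ seedsOfAngles hn Δ F a c,
        (∃ w ∈ translationLattice n Δ, (r : Seed) = (s : Seed).translate w) ∨
        ∃ w ∈ translationLattice n Δ, (r : Seed) = (t : Seed).translate w := by
  obtain ⟨s, hs, hsa, hsc⟩ := h
  have ht := SeedParams.MutationEquiv.glide_of_glide (.refl _) hy hs
  refine ⟨⟨_, hF.mem_mutationClass_iff.2 ⟨s, hs, rfl⟩⟩, ⟨s, hs, rfl, hsa, hsc⟩,
    ⟨_, hF.mem_mutationClass_iff.2 ⟨_, ht, rfl⟩⟩, ⟨_, ht, rfl, hsa, hsc⟩, ?_, ?_⟩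
  · rintro ⟨w, -, hw⟩
    obtain ⟨r, -, hr⟩ := SeedParams.eq_glide_of_translate hw
    have hε : -1 * s.ε = 1 * s.ε := congrArg SeedParams.ε hr
    exact absurd (mul_right_cancel hε) (by decide)
  · rintro q ⟨t, ht, hqt, hta, htc⟩
    obtain ⟨r, hr, h⟩ := SeedParams.exists_glide_of_same_angles hy hs ht (hta.trans hsa.symm)
      (htc.trans hsc.symm)
    have hw := hF.mem_translationLattice_iff.2 ⟨r, hr, rfl⟩
    refine h.imp (fun h => ⟨_, hw, ?_⟩) fun h => ⟨_, hw, ?_⟩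
    · rw [hqt, h, SeedParams.mk_seed_glide_one]
    · rw [hqt, h, ← SeedParams.mk_seed_glide_one, SeedParams.glide_glide, mul_one]

end IsBeltFrame

end Shape

end AffineSeed

end

open AffineSeed in
theorem theorem5p3 (n : ℕ) (hn : 1 ≤ n) (Δ₀ : Affine.Triangle ℝ Plane)
    (hΔ₀ : IsInitialTriangle n Δ₀) :
    ((∃ I, IsInitialBelt n Δ₀ I) ∧
      ∀ I, IsInitialBelt n Δ₀ I → ∀ w ∈ translationLattice n Δ₀,
        ∃ f : SimpleGraph.hasse ℤ ↪g exchangeGraph n Δ₀,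
          (∀ m, (f m : Seed) = (I m : Seed).translate w) ∧
          IsAcyclicBelt n Δ₀ (Set.range f)) ∧
    (∃ h : Plane, (2 : ℝ) • h ∈ translationLattice n Δ₀ ∧ ∀ m : Fin 3 → ℕ, m 0 + m 1 + m 2 = 2 * n + 1 →
      Nat.gcd (m 0) (Nat.gcd (m 1) (m 2)) = 1 →
      ∃ D : Fin 3 → AffFun,
        (∀ i, (D i).form (D i) = 2) ∧
        HasAngles D (fun i => m i * fundAngle n) ∧
        (∀ x : LabelledSeed, (⟦x⟧ : Seed) ∈ mutationClass n Δ₀ →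
          HasAngles x.v (fun i => m i * fundAngle n) → AreCongruent x.v D) ∧
        ∀ Q, IsQuiverOf (fun i => m i * fundAngle n) Q →
          (∃ s ∈ seedsOfShape n Δ₀ D Q, ∃ t ∈ seedsOfShape n Δ₀ D Q,
            (¬ ∃ w ∈ translationLattice n Δ₀, (t : Seed) = (s : Seed).translate w) ∧
            ∀ r ∈ seedsOfShape n Δ₀ D Q,
              (∃ w ∈ translationLattice n Δ₀, (r : Seed) = (s : Seed).translate w) ∨
              ∃ w ∈ translationLattice n Δ₀, (r : Seed) = (t : Seed).translate w) ∧
          ∀ s ∈ seedsOfShape n Δ₀ D Q, ∀ t ∈ seedsOfShape n Δ₀ D Q,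
            (∃ w ∈ translationLattice n Δ₀, (t : Seed) = (s : Seed).translate w) ∨
            ∃ w ∈ translationLattice n Δ₀,
              (t : Seed) = ((s : Seed).move (beltReflection Δ₀)).translate (h + w)) := by
  obtain ⟨F, hF⟩ := exists_isBeltFrame hn hΔ₀
  refine ⟨⟨hF.exists_isInitialBelt, fun I hI w hw => hF.exists_embedding_translate hI hw⟩, ?_⟩
  obtain ⟨y, hy⟩ := exists_mutationEquiv_glide hn
  have htwo : F.vec (y + y) 0 = (2 : ℝ) • F.vec y 0 := by
    simp only [F.vec_zero_right, add_mul, add_smul, two_smul]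
  refine ⟨F.vec y 0, hF.mem_translationLattice_iff.2 ⟨y + y, SeedParams.add_self_mem_period hy,
    htwo⟩, fun m hm hg => ?_⟩
  obtain ⟨d, ρ, hd⟩ := exists_seedParams_of_sum_eq hn hm hg
  refine ⟨((d.seed F).perm ρ).v, fun i => d.form_seed_self _, d.hasAngles_seed_perm_iff.2 hd,
    fun x hx hang => hF.areCongruent_of_hasAngles hd hx hang, fun Q hQ => ?_⟩
  obtain ⟨s, σ, hs, rfl⟩ := hQ.exists_seedParams hm
  have hreach : (initialParams hn).Reaches s.a s.c :=
    SeedParams.reaches_of_gcd_eq_one (Nat.gcd_one_left _) s.one_le_a s.a_le s.c_le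
      (SeedParams.gcd_eq_one hs hg)
  rw [hF.seedsOfShape_eq hd hs]
  exact ⟨hF.exists_two_translation_classes hy hreach,
    fun p hp q hq => hF.exists_translate_or_glideReflection hy hp hq⟩
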